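/- Let $d$ be a prime, $n,r,s\ge 0$ integers, $t=r+s$, and $T=\mathbb{Z}_d^{t}$. Put $\omega=e^{2\pi i/d}$, $\tau=(-1)^d e^{i\pi/d}$, and let $D$ be the order of $\tau$ ($D=4$ if $d=2$, $D=d$ if $d$ is odd). Let $\mathrm{Cl}$ be the $n$-qudit Clifford group, i.e. the group of unitaries on $(\mathbb{C}^d)^{\otimes n}$ generated by the Fourier transform $\mathrm H=d^{-1/2}\sum_{x,y}\omega^{xy}|x\rangle\langle y|$ and the phase gate $\mathrm P=\sum_x\tau^{x^2}|x\rangle\langle x|$ ($d=2$), $\mathrm P=\sum_x\tau^{x(x-1)}|x\rangle\langle x|$ ($d$ odd), on any qudit, and by $\mathrm{CADD}=\sum_{x,y}|x,x+y\rangle\langle x,y|$ on any ordered pair of distinct qudits. Let $\Delta_{r,s}(U)=U^{\otimes r}\otimes\bar U^{\otimes s}$, a representation of $\mathrm{Cl}$ on $\mathcal H_{n,t}=((\mathbb{C}^d)^{\otimes n})^{\otimes t}\simeq((\mathbb{C}^d)^{\otimes t})^{\otimes n}$. Let $s_i=1$ for $i\le r$ and $s_i=-1$ for $i>r$; let $\beta_{r,s}(u,v)=\sum_i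 s_iu_iv_i\in\mathbb{Z}_d$, and $q_{r,s}(u)=\sum_i s_i u_i^2\in\mathbb{Z}_D$ (with $u_i$ represented in $\{0,\dots,d-1\}$). A subspace $N\subseteq T$ is isotropic if $q_{r,s}|_N=0$, and stochastic if $\mathbf 1_t=(1,\dots,1)\in N^\perp$, where $N^\perp$ is the orthocomplement with respect to $\beta_{r,s}$. The associated code is $$C_N=\mathrm{span}\{|[f_1]_N\rangle\otimes\cdots\otimes|[f_n]_N\rangle : f_1,\dots,f_n\in N^\perp\}\subseteq\mathcal H_{n,t},\qquad |[f]_N\rangle=|N|^{-1/2}\sum_{u\in N}|f+u\rangle\in(\mathbb{C}^d)^{\otimes t}.$$ For integers $a,b$, possibly negative, $\Delta_{a,b}$ denotes, up to isomorphism, any $\Delta_{r',s'}$ with integers $r',s'\ge0$ such that $r'+s'=a+b$ and: $a-b\equiv r'-s' \pmod 8$ if $d=2$; $a-b\equiv r'-s'\pmod d$ and $b\equiv s'\pmod 2$ if $d$ is odd. **Lemma.** Let $N\subseteq T$ be a stochastic isotropic subspace of dimension $m$ with $\mathbf 1_t\notin N$. Then $C_N$ is invariant under $\Delta_{r,s}(\mathrm{Cl})$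 and $\Delta_{r,s}|_{C_N}\simeq\Delta_{r-m,s-m}$ as representations of $\mathrm{Cl}$. That is, $\Delta_{r,s}|_{C_N}\simeq\Delta_{r',s'}$ for every pair $r',s'\ge 0$ as above with $(a,b)=(r-m,s-m)$; moreover, if $d=2$, such a pair always exists. (If $d$ is odd and $r-m$ or $s-m$ is negative, the statement is made whenever $\Delta_{r-m,s-m}$ is defined, i.e. whenever such a pair exists.) -/

import Mathlib

open scoped BigOperators

noncomputable section

namespace CliffordTensor

/-! ### Tensor products of matrices -/

/-- The tensor product `⨂ i, A i` of a family of `κ × κ` matrices, as a matrix on `ι → κ`. -/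
def tensorMat {ι κ : Type*} [Fintype ι] (A : ι → Matrix κ κ ℂ) :
    Matrix (ι → κ) (ι → κ) ℂ :=
  Matrix.of fun x y => ∏ i, A i (x i) (y i)

theorem tensorMat_mul {ι κ : Type*} [Fintype ι] [DecidableEq ι] [Fintype κ]
    (A B : ι → Matrix κ κ ℂ) :
    tensorMat A * tensorMat B = tensorMat fun i => A i * B i := by
  ext x y
  simp only [tensorMat, Matrix.mul_apply, Matrix.of_apply, ← Finset.prod_mul_distrib]
  rw [Finset.prod_univ_sum, Fintype.piFinset_univ]

theorem tensorMat_one {ι κ : Type*} [Fintype ι] [DecidableEq κ] :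
    tensorMat (fun _ : ι => (1 : Matrix κ κ ℂ)) = 1 := by
  ext x y
  simp only [tensorMat, Matrix.of_apply, Matrix.one_apply]
  by_cases h : x = y
  · simp [h]
  · obtain ⟨i, hi⟩ := Function.ne_iff.mp h
    rw [if_neg h]
    exact Finset.prod_eq_zero (Finset.mem_univ i) (if_neg hi)

theorem star_tensorMat {ι κ : Type*} [Fintype ι] (A : ι → Matrix κ κ ℂ) :
    star (tensorMat A) = tensorMat fun i => star (A i) := by
  ext x y
  simp [tensorMat, Matrix.star_apply]

theorem tensorMat_mem_unitaryGroup {ι κ : Type*} [Fintype ι] [DecidableEq ι] [Fintype κ]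
    [DecidableEq κ] {A : ι → Matrix κ κ ℂ} (hA : ∀ i, A i ∈ Matrix.unitaryGroup κ ℂ) :
    tensorMat A ∈ Matrix.unitaryGroup (ι → κ) ℂ := by
  rw [Matrix.mem_unitaryGroup_iff, star_tensorMat, tensorMat_mul]
  simp only [fun i => Matrix.mem_unitaryGroup_iff.mp (hA i)]
  exact tensorMat_one

/-! ### The Clifford group -/

section Clifford

/-- `τ = (-1)^d exp(iπ/d)`. -/
def tau (d : ℕ) : ℂ := (-1) ^ d * Complex.exp (Complex.I * Real.pi / d)

/-- `D` is the order of `τ`: `2d` for even `d`, and `d` for odd `d`. -/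
def bigD (d : ℕ) : ℕ := if Even d then 2 * d else d

/-- The discrete Fourier transform `H = d^{-1/2} ∑ ω^{xy} |x⟩⟨y|`, `ω = exp(2πi/d)`. -/
def fourierMat (d : ℕ) [NeZero d] : Matrix (ZMod d) (ZMod d) ℂ :=
  Matrix.of fun x y => ((Real.sqrt d : ℝ) : ℂ)⁻¹ * ZMod.stdAddChar (x * y)

/-- The phase gate: `∑ τ^{x²} |x⟩⟨x|` for even `d`, `∑ τ^{x(x-1)} |x⟩⟨x|` for odd `d`. -/
def phaseMat (d : ℕ) : Matrix (ZMod d) (ZMod d) ℂ :=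
  Matrix.diagonal fun x =>
    if Even d then tau d ^ ((x.val : ℤ) ^ 2) else tau d ^ ((x.val : ℤ) * ((x.val : ℤ) - 1))

/-- The action of a single-qudit matrix `g` on the `j`-th of `n` qudits. -/
def onQudit {d n : ℕ} (j : Fin n) (g : Matrix (ZMod d) (ZMod d) ℂ) :
    Matrix (Fin n → ZMod d) (Fin n → ZMod d) ℂ :=
  tensorMat (Function.update (fun _ => 1) j g)

/-- Controlled addition with control `i` and target `j`: `|y⟩ ↦ |y + y_i e_j⟩`. -/
def caddMat {d n : ℕ} (i j : Fin n) : Matrix (Fin n → ZMod d) (Fin n → ZMod d) ℂ :=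
  Matrix.of fun x y => if x = Function.update y j (y i + y j) then 1 else 0

theorem norm_tau (d : ℕ) : ‖tau d‖ = 1 := by
  have h : Complex.I * Real.pi / d = ((Real.pi / d : ℝ) : ℂ) * Complex.I := by
    push_cast; ring
  rw [tau, h, norm_mul, Complex.norm_exp_ofReal_mul_I]
  simp

theorem fourierMat_mem (d : ℕ) [NeZero d] :
    fourierMat d ∈ Matrix.unitaryGroup (ZMod d) ℂ := by
  rw [Matrix.mem_unitaryGroup_iff]
  ext x y
  have hd : (d : ℂ) ≠ 0 := Nat.cast_ne_zero.mpr (NeZero.ne d)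
  have hs : ((Real.sqrt d : ℝ) : ℂ)⁻¹ * ((Real.sqrt d : ℝ) : ℂ)⁻¹ = (d : ℂ)⁻¹ := by
    rw [← mul_inv, ← Complex.ofReal_mul, Real.mul_self_sqrt (Nat.cast_nonneg d)]
    simp
  have key : ∀ z : ZMod d, fourierMat d x z * star (fourierMat d) z y
      = (d : ℂ)⁻¹ * ZMod.stdAddChar (z * (x - y)) := by
    intro z
    have h1 : star (ZMod.stdAddChar (y * z) : ℂ) = ZMod.stdAddChar (-(y * z)) := by
      rw [AddChar.map_neg_eq_conj]; rfl
    have h2 : z * (x - y) = x * z + -(y * z) := by ring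
    simp only [fourierMat, Matrix.star_apply, Matrix.of_apply, star_mul', h1, h2,
      AddChar.map_add_eq_mul, ← hs]
    simp
    ring
  rw [Matrix.mul_apply, Finset.sum_congr rfl fun z _ => key z, ← Finset.mul_sum,
    AddChar.sum_mulShift _ (ZMod.isPrimitive_stdAddChar d), ZMod.card, Matrix.one_apply]
  by_cases h : x = y
  · simp [h, hd]
  · simp [h, sub_ne_zero.mpr h]

theorem phaseMat_mem (d : ℕ) [NeZero d] : phaseMat d ∈ Matrix.unitaryGroup (ZMod d) ℂ := by
  rw [Matrix.mem_unitaryGroup_iff, Matrix.star_eq_conjTranspose, phaseMat,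
    Matrix.diagonal_conjTranspose, Matrix.diagonal_mul_diagonal, ← Matrix.diagonal_one]
  congr 1
  ext x
  have h : ∀ z : ℂ, ‖z‖ = 1 → z * star z = 1 := by
    intro z hz
    have := Complex.mul_conj z
    rw [Complex.normSq_eq_norm_sq, hz] at this
    simpa using this
  apply h
  split_ifs <;> simp [norm_zpow, norm_tau]

theorem onQudit_mem {d n : ℕ} [NeZero d] (j : Fin n) {g : Matrix (ZMod d) (ZMod d) ℂ}
    (hg : g ∈ Matrix.unitaryGroup (ZMod d) ℂ) :
    onQudit j g ∈ Matrix.unitaryGroup (Fin n → ZMod d) ℂ := by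
  refine tensorMat_mem_unitaryGroup fun i => ?_
  by_cases h : i = j
  · subst h; simpa using hg
  · simp [Function.update_of_ne h, one_mem]

theorem caddMat_mem {d n : ℕ} [NeZero d] {i j : Fin n} (hij : i ≠ j) :
    caddMat (d := d) i j ∈ Matrix.unitaryGroup (Fin n → ZMod d) ℂ := by
  have hinj : ∀ y z : Fin n → ZMod d, Function.update y j (y i + y j)
      = Function.update z j (z i + z j) → y = z := by
    intro y z h
    have hk : ∀ k, k ≠ j → y k = z k := by
      intro k hk
      simpa [Function.update_of_ne hk] using congrFun h k
    have hj : y i + y j = z i + z j := by simpa using congrFun h j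
    ext k
    by_cases hkj : k = j
    · subst hkj; rw [hk i hij] at hj; exact add_left_cancel hj
    · exact hk k hkj
  rw [Matrix.mem_unitaryGroup_iff']
  ext x y
  simp only [Matrix.mul_apply, Matrix.star_apply, caddMat, Matrix.of_apply, Matrix.one_apply]
  by_cases h : x = y
  · simp [h]
  · rw [if_neg h]
    refine Finset.sum_eq_zero fun z _ => ?_
    by_cases hz : z = Function.update x j (x i + x j)
    · have : z ≠ Function.update y j (y i + y j) := fun h' => h (hinj _ _ (hz ▸ h'))
      simp [this]
    · simp [hz]

/-- The `n`-qudit Clifford group: the subgroup of the unitary group of `(ℂ^d)^{⊗n}` generated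
by the Fourier transform and the phase gate on any qudit and controlled addition on any ordered
pair of distinct qudits. -/
def cliffordGroup (d n : ℕ) [NeZero d] :
    Subgroup (Matrix.unitaryGroup (Fin n → ZMod d) ℂ) :=
  Subgroup.closure
    ({U | ∃ j, U = ⟨onQudit j (fourierMat d), onQudit_mem j (fourierMat_mem d)⟩} ∪
     {U | ∃ j, U = ⟨onQudit j (phaseMat d), onQudit_mem j (phaseMat_mem d)⟩} ∪
     {U | ∃ (i j : Fin n) (hij : i ≠ j), U = ⟨caddMat i j, caddMat_mem hij⟩})

end Clifford

/-! ### Tensor power representations -/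

section TensorPower

/-- The space `H_{n,t} = ((ℂ^d)^{⊗n})^{⊗t}`, as functions of the `t × n` matrices over `ℤ/d`
labelling its standard basis. -/
abbrev GridSpace (d n t : ℕ) : Type := (Fin t → Fin n → ZMod d) → ℂ

/-- `U^{⊗r} ⊗ Ū^{⊗s}`. -/
def tensorPowerMat {κ : Type*} (r s : ℕ) (U : Matrix κ κ ℂ) :
    Matrix (Fin (r + s) → κ) (Fin (r + s) → κ) ℂ :=
  tensorMat fun i : Fin (r + s) => if (i : ℕ) < r then U else U.map (starRingEnd ℂ)

theorem tensorPowerMat_one {κ : Type*} [DecidableEq κ] (r s : ℕ) :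
    tensorPowerMat r s (1 : Matrix κ κ ℂ) = 1 := by
  simp only [tensorPowerMat, Matrix.map_one, map_zero, map_one, ite_self]
  exact tensorMat_one

theorem tensorPowerMat_mul {κ : Type*} [Fintype κ] (r s : ℕ) (U V : Matrix κ κ ℂ) :
    tensorPowerMat r s (U * V) = tensorPowerMat r s U * tensorPowerMat r s V := by
  rw [tensorPowerMat, tensorPowerMat, tensorPowerMat, tensorMat_mul]
  congr 1
  ext1 i
  split_ifs
  · rfl
  · exact Matrix.map_mul

/-- The representation `Δ_{r,s}(U) = U^{⊗r} ⊗ Ū^{⊗s}` of the Clifford group. -/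
def Delta (d n : ℕ) [NeZero d] (r s : ℕ) :
    Representation ℂ (cliffordGroup d n) (GridSpace d n (r + s)) where
  toFun U := Matrix.toLin' (tensorPowerMat r s (U : Matrix.unitaryGroup _ ℂ).1)
  map_one' := by
    simp only [OneMemClass.coe_one, tensorPowerMat_one, Matrix.toLin'_one]
    rfl
  map_mul' U V := by
    have h : ((U * V : cliffordGroup d n) : Matrix.unitaryGroup (Fin n → ZMod d) ℂ).1
        = (U : Matrix.unitaryGroup _ ℂ).1 * (V : Matrix.unitaryGroup _ ℂ).1 := rfl
    rw [h, tensorPowerMat_mul, Matrix.toLin'_mul]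
    rfl

/-- `ExtendsTo d a b r' s'`: for integers `a`, `b`, possibly negative, `Δ_{a,b}` is by
convention (the isomorphism class of) `Δ_{r',s'}`. -/
def ExtendsTo (d : ℕ) (a b : ℤ) (r' s' : ℕ) : Prop :=
  a + b = r' + s' ∧
    if d = 2 then a - b ≡ r' - s' [ZMOD 8]
    else a - b ≡ r' - s' [ZMOD d] ∧ b ≡ s' [ZMOD 2]

end TensorPower

/-! ### The model quadratic space and its code spaces -/

section Codes

/-- The signs `s_i`: `1` on the first `r` coordinates, `-1` on the last `s`. -/
def sgn (r s : ℕ) (i : Fin (r + s)) : ℤ := if (i : ℕ) < r then 1 else -1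

/-- The symmetric form `β_{r,s}` on `T = (ℤ/d)^{r+s}`, with matrix `diag(1,…,1,-1,…,-1)`. -/
def beta (d r s : ℕ) : LinearMap.BilinForm (ZMod d) (Fin (r + s) → ZMod d) :=
  Matrix.toBilin' (Matrix.diagonal fun i => (sgn r s i : ZMod d))

/-- The generalized quadratic form `q_{r,s} : T → ℤ/D`, with matrix `diag(1,…,1,-1,…,-1)`. -/
def quad (d r s : ℕ) (u : Fin (r + s) → ZMod d) : ZMod (bigD d) :=
  ∑ i, (sgn r s i : ZMod (bigD d)) * ((u i).val : ZMod (bigD d)) ^ 2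

/-- Isotropic subspaces: `q_{r,s}` vanishes on `N`. -/
def IsIsotropic {d r s : ℕ} (N : Submodule (ZMod d) (Fin (r + s) → ZMod d)) : Prop :=
  ∀ u ∈ N, quad d r s u = 0

/-- Stochastic subspaces: the all-ones vector lies in `N^⊥`. -/
def IsStochastic {d r s : ℕ} (N : Submodule (ZMod d) (Fin (r + s) → ZMod d)) : Prop :=
  (1 : Fin (r + s) → ZMod d) ∈ (beta d r s).orthogonal N

open Classical in
/-- The coset state `|[u]_N⟩ = |N|^{-1/2} ∑_{v ∈ N} |u + v⟩` in `(ℂ^d)^{⊗t}`. -/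
def cosetState {d t : ℕ} (N : Submodule (ZMod d) (Fin t → ZMod d)) (u : Fin t → ZMod d) :
    (Fin t → ZMod d) → ℂ :=
  fun w => if w - u ∈ N then ((Real.sqrt (Nat.card N) : ℝ) : ℂ)⁻¹ else 0

/-- `|[f_1]_N⟩ ⊗ ⋯ ⊗ |[f_n]_N⟩`, the `j`-th factor sitting on the `j`-th column of the grid. -/
def cosetStateProd {d n t : ℕ} (N : Submodule (ZMod d) (Fin t → ZMod d))
    (f : Fin n → Fin t → ZMod d) : GridSpace d n t :=
  fun G => ∏ j, cosetState N (f j) fun i => G i j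

/-- The tensor power CSS code `C_N`: the span of the products of coset states with
`f_1, …, f_n ∈ N^⊥`. -/
def codeSpace {d r s : ℕ} (n : ℕ) (N : Submodule (ZMod d) (Fin (r + s) → ZMod d)) :
    Submodule ℂ (GridSpace d n (r + s)) :=
  Submodule.span ℂ {ψ | ∃ f : Fin n → Fin (r + s) → ZMod d,
    (∀ j, f j ∈ (beta d r s).orthogonal N) ∧ ψ = cosetStateProd N f}

end Codes

end CliffordTensor

end

open scoped BigOperators

noncomputable section

namespace CliffordTensor

/-! ### Arithmetic modulo `d` and modulo `D` -/

section Arithmetic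

variable {d : ℕ}

/-! On products of coset states the generators act by formulas that involve only addition, `β`, `q`
and `β(1, ·)`, all taken modulo `N`. The Fourier transform gives a character sum over `N^⊥`, the
phase gate multiplies by a power of `τ` that is constant on cosets of `N`, and controlled addition
adds labels. Hence `C_N` is invariant. Moreover, any linear `Φ` from the model space of type `(r',
s')` into `N^⊥` that preserves `β` and `q`, is a bijection onto `N^⊥` modulo `N`, and sends `1` to
`1` modulo `N` yields an intertwiner: a basis vector goes to the product of the coset states of its
columns under `Φ`. The case `N = ⊥` describes the model itself.

It remains to find `Φ` (`IsCodeModel`), that is, an orthogonal family in `N^⊥` with `q = ±1` in the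
prescribed pattern and sum congruent to `1` modulo `N`. The invariant that controls it is the Gauss
sum of `τ^q`: by `sum_tauChar_quad_orthogonal` it is the same over `T` and over `N^⊥`, and over
`N^⊥` it factors along an orthogonal family (`prod_quadGauss`).

For odd `d`, all norms but one can be prescribed freely; the Gauss sum fixes the square class of the
last, which is then rescaled. The sum of the family and `1` have the same norm because `r - s ≡ r' -
s'` modulo `d`, and both lie outside `N`, so Witt's theorem for one vector
(`IsRadical.exists_isometry`) moves one to the other.

For `d = 2`, `1` is a characteristic vector, `β(1, y) = β(y, y)`, so `1 ∉ N` says that `β` is not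
alternating on `N^⊥` and an orthonormal family exists. The Gauss sum fixes the number of vectors
with `q = 1` modulo 4, and `exists_flip` changes four equal signs at once, so every admissible
signature occurs. The sum of the family is again characteristic, hence equal to `1` modulo `N` with
no further adjustment. -/

instance [NeZero d] : NeZero (bigD d) :=
  ⟨by have := NeZero.ne d; unfold bigD; split_ifs <;> omega⟩

theorem bigD_dvd_two_mul (d : ℕ) : bigD d ∣ 2 * d := by
  unfold bigD; split_ifs
  · rfl
  · exact Dvd.intro_left 2 rfl

/-- Squares of residues modulo `d` are well defined modulo `D`: for even `d`, both terms of `(dk)^2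
+ 2b(dk)` are divisible by `2d`. -/
theorem intCast_sq_congr {a b : ℤ} (h : (a : ZMod d) = b) :
    (a : ZMod (bigD d)) ^ 2 = (b : ZMod (bigD d)) ^ 2 := by
  have h1 : (d : ℤ) ∣ a - b := by
    rw [← ZMod.intCast_zmod_eq_zero_iff_dvd]; push_cast; rw [h, sub_self]
  have h2 : ((bigD d : ℕ) : ℤ) ∣ a ^ 2 - b ^ 2 := by
    obtain ⟨k, hk⟩ := h1
    have ha : a = b + d * k := by linarith
    unfold bigD
    split_ifs with hd
    · obtain ⟨c, hc⟩ := hd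
      exact ⟨k * (c * k + b), by rw [ha, hc]; push_cast; ring⟩
    · exact ⟨k * (d * k + 2 * b), by rw [ha]; ring⟩
  have := (ZMod.intCast_zmod_eq_zero_iff_dvd (a ^ 2 - b ^ 2) (bigD d)).mpr h2
  push_cast at this
  exact sub_eq_zero.mp this

/-- The square `ℤ/d → ℤ/D`. -/
def sq (x : ZMod d) : ZMod (bigD d) := (x.val : ZMod (bigD d)) ^ 2

/-- Multiplication by two, as a map `ℤ/d → ℤ/D`. -/
def dbl (x : ZMod d) : ZMod (bigD d) := 2 * (x.val : ZMod (bigD d))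

variable [NeZero d]

theorem sq_intCast (a : ℤ) : sq (a : ZMod d) = (a : ZMod (bigD d)) ^ 2 := by
  have := intCast_sq_congr (d := d) (a := ((a : ZMod d).val : ℤ)) (b := a) (by simp)
  rw [← this]; simp [sq]

theorem dbl_intCast (a : ℤ) : dbl (a : ZMod d) = 2 * (a : ZMod (bigD d)) := by
  have h1 : (d : ℤ) ∣ a - ((a : ZMod d).val : ℤ) := by
    rw [← ZMod.intCast_zmod_eq_zero_iff_dvd]; simp
  have h2 : ((bigD d : ℕ) : ℤ) ∣ 2 * (a - ((a : ZMod d).val : ℤ)) := by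
    refine dvd_trans (Int.natCast_dvd_natCast.mpr (bigD_dvd_two_mul d)) ?_
    push_cast
    exact mul_dvd_mul_left 2 h1
  have := (ZMod.intCast_zmod_eq_zero_iff_dvd _ (bigD d)).mpr h2
  push_cast at this
  rw [dbl]
  linear_combination -this

theorem sq_add (x y : ZMod d) : sq (x + y) = sq x + sq y + dbl (x * y) := by
  obtain ⟨a, rfl⟩ := ZMod.intCast_surjective x
  obtain ⟨b, rfl⟩ := ZMod.intCast_surjective y
  rw [← Int.cast_add, ← Int.cast_mul]
  simp only [sq_intCast, dbl_intCast]
  push_cast; ring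

theorem sq_mul (x y : ZMod d) : sq (x * y) = sq x * sq y := by
  obtain ⟨a, rfl⟩ := ZMod.intCast_surjective x
  obtain ⟨b, rfl⟩ := ZMod.intCast_surjective y
  rw [← Int.cast_mul]
  simp only [sq_intCast]
  push_cast; ring

theorem sq_zero : sq (0 : ZMod d) = 0 := by
  simpa using sq_intCast (d := d) 0

theorem dbl_add (x y : ZMod d) : dbl (x + y) = dbl x + dbl y := by
  obtain ⟨a, rfl⟩ := ZMod.intCast_surjective x
  obtain ⟨b, rfl⟩ := ZMod.intCast_surjective y
  rw [← Int.cast_add]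
  simp only [dbl_intCast]
  push_cast; ring

theorem dbl_zero : dbl (0 : ZMod d) = 0 := by
  simpa using dbl_intCast (d := d) 0

theorem dbl_sum {ι : Type*} (s : Finset ι) (f : ι → ZMod d) :
    dbl (∑ i ∈ s, f i) = ∑ i ∈ s, dbl (f i) :=
  map_sum (⟨⟨dbl, dbl_zero⟩, dbl_add⟩ : ZMod d →+ ZMod (bigD d)) f s

theorem dbl_intCast_mul (a : ℤ) (x : ZMod d) : dbl ((a : ZMod d) * x) = (a : ZMod (bigD d)) * dbl x := by
  obtain ⟨b, rfl⟩ := ZMod.intCast_surjective x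
  rw [← Int.cast_mul]
  simp only [dbl_intCast]
  push_cast; ring

theorem tau_sq (d : ℕ) [NeZero d] : tau d ^ 2 = ZMod.stdAddChar (1 : ZMod d) := by
  have h := ZMod.stdAddChar_coe (N := d) 1
  simp only [Int.cast_one] at h
  rw [h, tau, mul_pow, ← pow_mul, mul_comm d 2, pow_mul, neg_one_sq, one_pow, one_mul,
    ← Complex.exp_nat_mul]
  congr 1; push_cast; ring

theorem tau_pow_bigD (d : ℕ) [NeZero d] : tau d ^ bigD d = 1 := by
  have hd : (d : ℂ) ≠ 0 := Nat.cast_ne_zero.mpr (NeZero.ne d)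
  unfold bigD
  split_ifs with h
  · rw [pow_mul, tau_sq, ← AddChar.map_nsmul_eq_pow]; simp
  · rw [Nat.not_even_iff_odd] at h
    have : (d : ℂ) * (Complex.I * Real.pi / d) = Real.pi * Complex.I := by
      field_simp
    rw [tau, mul_pow, ← Complex.exp_nat_mul, this, Complex.exp_pi_mul_I, h.neg_one_pow,
      h.neg_one_pow]
    norm_num

/-- The additive character of `ℤ/D` sending `1` to `τ`. -/
def tauChar (d : ℕ) [NeZero d] : AddChar (ZMod (bigD d)) ℂ :=
  AddChar.zmodChar (bigD d) (tau_pow_bigD d)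

theorem tauChar_intCast (a : ℤ) : tauChar d a = tau d ^ a := by
  have h1 : tauChar d 1 = tau d := by
    have := AddChar.zmodChar_apply' (tau_pow_bigD d) 1
    simpa [tauChar] using this
  rw [← h1, ← AddChar.map_zsmul_eq_zpow]; simp

theorem tauChar_dbl (x : ZMod d) : tauChar d (dbl x) = ZMod.stdAddChar x := by
  obtain ⟨a, rfl⟩ := ZMod.intCast_surjective x
  have h1 : (a : ZMod d) = a • (1 : ZMod d) := by simp
  have h2 : (2 : ZMod (bigD d)) * (a : ZMod (bigD d)) = ((2 * a : ℤ) : ZMod (bigD d)) := by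
    push_cast; ring
  rw [dbl_intCast, h2, tauChar_intCast, h1, AddChar.map_zsmul_eq_zpow, ← tau_sq, zpow_mul]
  norm_cast

/-- Since `τ^2 = ω`, doubling followed by `τ^(·)` is the faithful character `ω^(·)`. This lets `β`
be recovered from `q` by polarization, even when `d = 2`. -/
theorem dbl_injective : Function.Injective (dbl : ZMod d → ZMod (bigD d)) := by
  intro x y h
  apply ZMod.injective_stdAddChar
  rw [← tauChar_dbl, h, tauChar_dbl]

theorem tauChar_neg_eq_star (x : ZMod (bigD d)) :
    tauChar d (-x) = starRingEnd ℂ (tauChar d x) :=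
  AddChar.map_neg_eq_conj _ _

end Arithmetic

/-! ### The forms `β` and `q` -/

section Forms

variable {d r s : ℕ}

theorem beta_apply (u v : Fin (r + s) → ZMod d) :
    beta d r s u v = ∑ i, (sgn r s i : ZMod d) * (u i * v i) := by
  simp only [beta, Matrix.toBilin'_apply', Matrix.mulVec_diagonal, dotProduct]
  exact Finset.sum_congr rfl fun i _ => by ring

theorem beta_comm (u v : Fin (r + s) → ZMod d) : beta d r s u v = beta d r s v u := by
  simp only [beta_apply, mul_comm (u _)]

theorem beta_isRefl : (beta d r s).IsRefl := fun u v h => by rw [beta_comm, h]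

theorem sgn_mul_self (i : Fin (r + s)) : sgn r s i * sgn r s i = 1 := by
  unfold sgn; split_ifs <;> rfl

theorem sgn_cast_mul_self {R : Type*} [Ring R] (i : Fin (r + s)) :
    (sgn r s i : R) * (sgn r s i : R) = 1 := by
  rw [← Int.cast_mul, sgn_mul_self, Int.cast_one]

theorem beta_single (u : Fin (r + s) → ZMod d) (i : Fin (r + s)) :
    beta d r s u (Pi.single i (sgn r s i : ZMod d)) = u i := by
  rw [beta_apply, Finset.sum_eq_single i]
  · rw [Pi.single_eq_same, mul_comm (u i), ← mul_assoc, sgn_cast_mul_self, one_mul]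
  · intro j _ hj; simp [Pi.single_eq_of_ne hj]
  · simp

theorem beta_nondegenerate : (beta d r s).Nondegenerate := by
  have h : ∀ u, (∀ v, beta d r s u v = 0) → u = 0 := fun u hu => by
    ext i; rw [← beta_single u i, hu]; rfl
  exact ⟨h, fun u hu => h u fun v => by rw [beta_comm, hu]⟩

theorem quad_eq_sum (u : Fin (r + s) → ZMod d) :
    quad d r s u = ∑ i, (sgn r s i : ZMod (bigD d)) * sq (u i) := rfl

variable [NeZero d]

theorem quad_add (u v : Fin (r + s) → ZMod d) :
    quad d r s (u + v) = quad d r s u + quad d r s v + dbl (beta d r s u v) := by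
  simp only [quad_eq_sum, beta_apply, dbl_sum, ← Finset.sum_add_distrib, Pi.add_apply, sq_add,
    dbl_intCast_mul]
  exact Finset.sum_congr rfl fun i _ => by ring

theorem quad_smul (c : ZMod d) (u : Fin (r + s) → ZMod d) :
    quad d r s (c • u) = sq c * quad d r s u := by
  simp only [quad_eq_sum, Finset.mul_sum, Pi.smul_apply, smul_eq_mul, sq_mul]
  exact Finset.sum_congr rfl fun i _ => by ring

theorem quad_zero : quad d r s 0 = 0 := by simp [quad_eq_sum, sq_zero]

/-- Compare `q(2u) = 4 q(u)` with the polarization of `q(u + u)`. -/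
theorem dbl_beta_self (u : Fin (r + s) → ZMod d) :
    dbl (beta d r s u u) = 2 * quad d r s u := by
  have h := quad_add u u
  rw [← two_smul (ZMod d) u, quad_smul] at h
  have h2 : sq (2 : ZMod d) = 4 := by
    have := sq_intCast (d := d) 2
    push_cast at this; rw [this]; norm_num
  rw [h2] at h
  linear_combination -h

theorem quad_sum {k : ℕ} (φ : Fin k → Fin (r + s) → ZMod d)
    (h : ∀ i j, i ≠ j → beta d r s (φ i) (φ j) = 0) (x : Fin k → ZMod d) (S : Finset (Fin k)) :
    quad d r s (∑ i ∈ S, x i • φ i) = ∑ i ∈ S, sq (x i) * quad d r s (φ i) := by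
  classical
  induction S using Finset.induction_on with
  | empty => simp [quad_zero]
  | insert a S ha ih =>
    rw [Finset.sum_insert ha, Finset.sum_insert ha, quad_add, ih, quad_smul, map_sum,
      Finset.sum_eq_zero (f := fun j => beta d r s (x a • φ a) (x j • φ j)), dbl_zero, add_zero]
    intro j hj
    have : a ≠ j := fun h => ha (h ▸ hj)
    simp [h a j this]

theorem IsIsotropic.beta_eq_zero {N : Submodule (ZMod d) (Fin (r + s) → ZMod d)}
    (hN : IsIsotropic N) {u v : Fin (r + s) → ZMod d} (hu : u ∈ N) (hv : v ∈ N) :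
    beta d r s u v = 0 := by
  have h := quad_add u v
  rw [hN _ hu, hN _ hv, hN _ (N.add_mem hu hv)] at h
  apply dbl_injective
  rw [dbl_zero]; simpa using h.symm

end Forms

/-! ### The generators acting on products of coset states -/

section Action

open Classical

variable {d n r s : ℕ}

theorem tensorPowerMat_tensorMat_apply {ι κ : Type*} [Fintype ι]
    (A : ι → Matrix κ κ ℂ) (G G' : Fin (r + s) → ι → κ) :
    tensorPowerMat r s (tensorMat A) G G' =
      ∏ k, tensorPowerMat r s (A k) (fun i => G i k) fun i => G' i k := by
  simp only [tensorPowerMat, tensorMat, Matrix.of_apply]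
  rw [Finset.prod_comm]
  refine Finset.prod_congr rfl fun i _ => ?_
  split_ifs <;> simp

/-- This is the regrouping of `t` copies of `n` qudits into `n` columns of length `t`: a local gate
acts on each column separately. -/
theorem tensorPowerMat_tensorMat_mulVec {ι κ : Type*} [Fintype ι] [DecidableEq ι] [Fintype κ]
    (A : ι → Matrix κ κ ℂ) (c : ι → (Fin (r + s) → κ) → ℂ) :
    (tensorPowerMat r s (tensorMat A)).mulVec (fun G => ∏ k, c k fun i => G i k) =
      fun G => ∏ k, (tensorPowerMat r s (A k)).mulVec (c k) fun i => G i k := by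
  ext G
  simp only [Matrix.mulVec, dotProduct, tensorPowerMat_tensorMat_apply,
    ← Finset.prod_mul_distrib]
  rw [Finset.prod_univ_sum, Fintype.piFinset_univ]
  exact Fintype.sum_equiv (Equiv.piComm fun _ _ => κ) _ _ fun G' => rfl

theorem tensorPowerMat_onQudit_mulVec [NeZero d] (j : Fin n) (g : Matrix (ZMod d) (ZMod d) ℂ)
    (c : Fin n → (Fin (r + s) → ZMod d) → ℂ) :
    (tensorPowerMat r s (onQudit j g)).mulVec (fun G => ∏ k, c k fun i => G i k) =
      fun G => ∏ k, Function.update c j ((tensorPowerMat r s g).mulVec (c j)) k fun i => G i k := by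
  rw [onQudit, tensorPowerMat_tensorMat_mulVec]
  ext G
  refine Finset.prod_congr rfl fun k _ => ?_
  by_cases h : k = j
  · subst h; simp
  · simp [Function.update_of_ne h, tensorPowerMat_one]

theorem prod_update_apply {ι α : Type*} [Fintype ι] [DecidableEq ι] (c : ι → α → ℂ) (j : ι) (v : α → ℂ)
    (x : ι → α) :
    ∏ k, Function.update c j v k (x k) = v (x j) * ∏ k ∈ Finset.univ \ {j}, c k (x k) := by
  have h : (fun k => Function.update c j v k (x k)) =
      Function.update (fun k => c k (x k)) j (v (x j)) := by
    ext k
    by_cases hk : k = j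
    · subst hk; simp
    · simp [Function.update_of_ne hk]
  rw [h]
  exact Finset.prod_update_of_mem (Finset.mem_univ j) _ _

theorem cosetStateProd_update {t : ℕ} (N : Submodule (ZMod d) (Fin t → ZMod d))
    (f : Fin n → Fin t → ZMod d) (j : Fin n) (w : Fin t → ZMod d) (G : Fin t → Fin n → ZMod d) :
    cosetStateProd N (Function.update f j w) G =
      cosetState N w (fun i => G i j) *
        ∏ k ∈ Finset.univ \ {j}, cosetState N (f k) fun i => G i k := by
  rw [← prod_update_apply (fun k => cosetState N (f k)) j (cosetState N w) fun k i => G i k]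
  refine Finset.prod_congr rfl fun k _ => ?_
  by_cases h : k = j
  · subst h; simp
  · simp [Function.update_of_ne h]

theorem cosetState_congr {t : ℕ} {N : Submodule (ZMod d) (Fin t → ZMod d)}
    {u v : Fin t → ZMod d} (h : u - v ∈ N) : cosetState N u = cosetState N v := by
  ext w
  have : w - u ∈ N ↔ w - v ∈ N := by
    rw [← N.add_mem_iff_left h]; simp
  simp only [cosetState, this]

theorem sum_ite_mem_submodule {t : ℕ} [NeZero d] (W : Submodule (ZMod d) (Fin t → ZMod d))
    (F : (Fin t → ZMod d) → ℂ) : ∑ x, (if x ∈ W then F x else 0) = ∑ u : W, F u := by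
  rw [← Finset.sum_filter]
  exact Finset.sum_subtype _ (by simp) F

theorem sum_mul_cosetState {t : ℕ} [NeZero d] (N : Submodule (ZMod d) (Fin t → ZMod d))
    (f : Fin t → ZMod d) (F : (Fin t → ZMod d) → ℂ) :
    ∑ x, F x * cosetState N f x =
      ((Real.sqrt (Nat.card N) : ℝ) : ℂ)⁻¹ * ∑ u : N, F (f + u) := by
  rw [← sum_ite_mem_submodule N fun u => F (f + u), Finset.mul_sum]
  refine (Fintype.sum_equiv (Equiv.addLeft f) _ _ fun x => ?_).symm
  simp only [cosetState, Equiv.coe_addLeft, add_sub_cancel_left]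
  split_ifs <;> ring

theorem sum_stdAddChar_beta [NeZero d] (N : Submodule (ZMod d) (Fin (r + s) → ZMod d))
    (w : Fin (r + s) → ZMod d) :
    ∑ u : N, (ZMod.stdAddChar (beta d r s w u) : ℂ) =
      if w ∈ (beta d r s).orthogonal N then (Nat.card N : ℂ) else 0 := by
  let ψ : AddChar N ℂ :=
    (ZMod.stdAddChar (N := d)).compAddMonoidHom ((beta d r s w).comp N.subtype).toAddMonoidHom
  have hψ : ∀ u : N, ψ u = ZMod.stdAddChar (beta d r s w u) := fun u => rfl
  have h := AddChar.sum_eq_ite ψ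
  simp only [hψ] at h
  rw [h, Nat.card_eq_fintype_card]
  refine if_congr ?_ rfl rfl
  rw [LinearMap.BilinForm.mem_orthogonal_iff]
  constructor
  · intro h0 u hu
    have := DFunLike.congr_fun h0 ⟨u, hu⟩
    rw [hψ, AddChar.zero_apply, ← AddChar.map_zero_eq_one (ZMod.stdAddChar (N := d))] at this
    rw [beta_comm]
    exact ZMod.injective_stdAddChar this
  · intro h0
    ext u
    rw [hψ, beta_comm, h0 u u.2, AddChar.map_zero_eq_one, AddChar.zero_apply]

theorem addChar_map_sum {A ι : Type*} [AddCommMonoid A] (ψ : AddChar A ℂ) (S : Finset ι)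
    (f : ι → A) : ψ (∑ i ∈ S, f i) = ∏ i ∈ S, ψ (f i) := by
  induction S using Finset.induction_on with
  | empty => simp
  | insert a S ha ih => rw [Finset.sum_insert ha, Finset.prod_insert ha, AddChar.map_add_eq_mul, ih]

/-! ### Fourier transform, phase gate and controlled addition on coset states. -/

theorem tensorPowerMat_fourierMat_apply [NeZero d] (w v : Fin (r + s) → ZMod d) :
    tensorPowerMat r s (fourierMat d) w v =
      ((Real.sqrt d : ℝ) : ℂ)⁻¹ ^ (r + s) * ZMod.stdAddChar (beta d r s w v) := by
  have h : ∀ i : Fin (r + s), (if (i : ℕ) < r then fourierMat d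
      else (fourierMat d).map (starRingEnd ℂ)) (w i) (v i) =
      ((Real.sqrt d : ℝ) : ℂ)⁻¹ * ZMod.stdAddChar ((sgn r s i : ZMod d) * (w i * v i)) := by
    intro i
    unfold sgn
    split_ifs
    · simp [fourierMat]
    · simp only [fourierMat, Matrix.map_apply, Matrix.of_apply, map_mul, map_inv₀,
        Complex.conj_ofReal, ← AddChar.map_neg_eq_conj]
      congr 2; push_cast; ring
  simp only [tensorPowerMat, tensorMat, Matrix.of_apply, h, Finset.prod_mul_distrib,
    Finset.prod_const, Finset.card_univ, Fintype.card_fin]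
  rw [beta_apply]
  congr 1
  exact (addChar_map_sum _ _ _).symm

variable [NeZero d]

theorem le_orthogonal_self {N : Submodule (ZMod d) (Fin (r + s) → ZMod d)} (hN : IsIsotropic N) :
    N ≤ (beta d r s).orthogonal N :=
  fun _ hu _ hv => hN.beta_eq_zero hv hu

/-- Summing the character over `f + N` kills every `w` outside `N^⊥`. The result is a sum over all
of `N^⊥` rather than over cosets, so no representatives need be chosen. -/
theorem fourier_mulVec_cosetState {N : Submodule (ZMod d) (Fin (r + s) → ZMod d)}
    (hN : IsIsotropic N) {f : Fin (r + s) → ZMod d} (hf : f ∈ (beta d r s).orthogonal N) :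
    (tensorPowerMat r s (fourierMat d)).mulVec (cosetState N f) =
      ((Real.sqrt d : ℝ) : ℂ)⁻¹ ^ (r + s) • ∑ v : (beta d r s).orthogonal N,
        (ZMod.stdAddChar (beta d r s v f) : ℂ) • cosetState N v := by
  ext w
  rw [Matrix.mulVec, dotProduct, sum_mul_cosetState]
  simp only [tensorPowerMat_fourierMat_apply, map_add, AddChar.map_add_eq_mul, ← mul_assoc,
    ← Finset.mul_sum, Pi.smul_apply, Finset.sum_apply, smul_eq_mul]
  rw [sum_stdAddChar_beta,
    ← sum_ite_mem_submodule _ fun v => ZMod.stdAddChar (beta d r s v f) * cosetState N v w]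
  -- As a function of `v`, the summand is supported on `w + N`, where both membership in `N^⊥` (as
  -- `N ≤ N^⊥`) and `β(v, f)` (as `f ∈ N^⊥`) are constant.
  have key : ∀ v, (if v ∈ (beta d r s).orthogonal N then
      (ZMod.stdAddChar (beta d r s v f) : ℂ) * cosetState N v w else 0) =
      (if w ∈ (beta d r s).orthogonal N then (ZMod.stdAddChar (beta d r s w f) : ℂ) else 0) *
        cosetState N w v := by
    intro v
    by_cases h : w - v ∈ N
    · have h1 : v ∈ (beta d r s).orthogonal N ↔ w ∈ (beta d r s).orthogonal N := by
        rw [← Submodule.add_mem_iff_right _ (le_orthogonal_self hN h)]; simp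
      have h2 : beta d r s v f = beta d r s w f := by
        have := hf _ h
        rw [map_sub, LinearMap.sub_apply, sub_eq_zero] at this
        exact this.symm
      have h3 : v - w ∈ N := by rw [← neg_sub]; exact N.neg_mem h
      simp only [cosetState, h1, h2, h, h3, if_true]
      split_ifs <;> simp
    · have h3 : v - w ∉ N := fun h' => h (by rw [← neg_sub]; exact N.neg_mem h')
      simp [cosetState, h, h3]
  rw [Finset.sum_congr rfl fun v _ => key v, ← Finset.mul_sum]
  have h4 := sum_mul_cosetState N w fun _ => 1
  simp only [one_mul, Finset.sum_const, Finset.card_univ, nsmul_eq_mul, mul_one] at h4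
  rw [h4, Nat.card_eq_fintype_card]
  split_ifs <;> ring

theorem fourier_mulVec_cosetStateProd {N : Submodule (ZMod d) (Fin (r + s) → ZMod d)}
    (hN : IsIsotropic N) {f : Fin n → Fin (r + s) → ZMod d} (j : Fin n)
    (hf : f j ∈ (beta d r s).orthogonal N) :
    (tensorPowerMat r s (onQudit j (fourierMat d))).mulVec (cosetStateProd N f) =
      ((Real.sqrt d : ℝ) : ℂ)⁻¹ ^ (r + s) • ∑ v : (beta d r s).orthogonal N,
        (ZMod.stdAddChar (beta d r s v (f j)) : ℂ) •
          cosetStateProd N (Function.update f j v) := by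
  have h := tensorPowerMat_onQudit_mulVec (r := r) (s := s) j (fourierMat d)
    fun k => cosetState N (f k)
  refine h.trans ?_
  ext G
  rw [fourier_mulVec_cosetState hN hf, prod_update_apply _ _ _ fun k i => G i k]
  simp only [Pi.smul_apply, Finset.sum_apply, smul_eq_mul, cosetStateProd_update, Finset.sum_mul,
    Finset.mul_sum, mul_assoc]

/-- The exponent of `τ` in the eigenvalues of the phase gate. -/
def phaseExp (d r s : ℕ) (u : Fin (r + s) → ZMod d) : ZMod (bigD d) :=
  quad d r s u -
    if Even d then 0 else ∑ i, (sgn r s i : ZMod (bigD d)) * ((u i).val : ZMod (bigD d))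

omit [NeZero d] in
theorem isUnit_two_of_not_even (hd : ¬ Even d) : IsUnit (2 : ZMod (bigD d)) := by
  have h : bigD d = d := if_neg hd
  have : IsUnit ((2 : ℕ) : ZMod (bigD d)) := by
    rw [ZMod.isUnit_iff_coprime, h, Nat.coprime_two_left]
    exact Nat.not_even_iff_odd.mp hd
  exact_mod_cast this

theorem two_mul_sum_sgn_val (u : Fin (r + s) → ZMod d) :
    2 * ∑ i, (sgn r s i : ZMod (bigD d)) * ((u i).val : ZMod (bigD d)) =
      dbl (beta d r s 1 u) := by
  rw [beta_apply, dbl_sum, Finset.mul_sum]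
  refine Finset.sum_congr rfl fun i _ => ?_
  rw [dbl_intCast_mul, Pi.one_apply, one_mul, dbl]
  ring

/-- For odd `d` the linear part of the exponent is `β(1, u)`; as 2 is invertible modulo `D`, this
can be checked after doubling. It is the reason why the all-ones vector matters. -/
theorem phaseExp_congr {r' s' : ℕ} {u : Fin (r + s) → ZMod d} {v : Fin (r' + s') → ZMod d}
    (hq : quad d r s u = quad d r' s' v) (hb : beta d r s 1 u = beta d r' s' 1 v) :
    phaseExp d r s u = phaseExp d r' s' v := by
  rw [phaseExp, phaseExp, hq]
  split_ifs with hd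
  · rfl
  · congr 1
    apply (isUnit_two_of_not_even hd).mul_left_cancel
    rw [two_mul_sum_sgn_val, two_mul_sum_sgn_val, hb]

theorem tensorPowerMat_phaseMat :
    tensorPowerMat r s (phaseMat d) =
      Matrix.diagonal fun w => tauChar d (phaseExp d r s w) := by
  have hE : ∀ x : ZMod d,
      (if Even d then tau d ^ ((x.val : ℤ) ^ 2) else tau d ^ ((x.val : ℤ) * ((x.val : ℤ) - 1))) =
      tauChar d (sq x - if Even d then 0 else (x.val : ZMod (bigD d))) := by
    intro x
    simp only [← tauChar_intCast, sq]
    split_ifs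
    · push_cast; rw [sub_zero]
    · push_cast; congr 1; ring
  ext w v
  simp only [tensorPowerMat, tensorMat, Matrix.of_apply, phaseMat, hE]
  by_cases h : w = v
  · subst h
    rw [Matrix.diagonal_apply_eq]
    have hsum : phaseExp d r s w = ∑ i, (sgn r s i : ZMod (bigD d)) *
        (sq (w i) - if Even d then 0 else ((w i).val : ZMod (bigD d))) := by
      simp only [phaseExp, quad_eq_sum, mul_sub, Finset.sum_sub_distrib]
      split_ifs <;> simp
    rw [hsum]
    refine Eq.trans (Finset.prod_congr rfl fun i _ => ?_)
      (addChar_map_sum _ _ _).symm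
    unfold sgn
    split_ifs <;> simp [← tauChar_neg_eq_star]
  · obtain ⟨i, hi⟩ := Function.ne_iff.mp h
    rw [Matrix.diagonal_apply_ne _ h]
    refine Finset.prod_eq_zero (Finset.mem_univ i) ?_
    split_ifs <;> simp [Matrix.diagonal_apply_ne _ hi]

/-- The exponent is constant on `f j + N`: isotropy and `f j ∈ N^⊥` fix `q`, and stochasticity fixes
`β(1, ·)`. -/
theorem phase_mulVec_cosetStateProd {N : Submodule (ZMod d) (Fin (r + s) → ZMod d)}
    (hN : IsIsotropic N) (hst : IsStochastic N) {f : Fin n → Fin (r + s) → ZMod d} (j : Fin n)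
    (hf : f j ∈ (beta d r s).orthogonal N) :
    (tensorPowerMat r s (onQudit j (phaseMat d))).mulVec (cosetStateProd N f) =
      tauChar d (phaseExp d r s (f j)) • cosetStateProd N f := by
  have h := tensorPowerMat_onQudit_mulVec (r := r) (s := s) j (phaseMat d)
    fun k => cosetState N (f k)
  refine h.trans ?_
  have h1 : (tensorPowerMat r s (phaseMat d)).mulVec (cosetState N (f j)) =
      tauChar d (phaseExp d r s (f j)) • cosetState N (f j) := by
    ext w
    rw [tensorPowerMat_phaseMat, Matrix.mulVec_diagonal, Pi.smul_apply, smul_eq_mul]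
    by_cases hw : w - f j ∈ N
    · congr 2
      have hw' : w = f j + (w - f j) := by abel
      apply phaseExp_congr
      · rw [hw', quad_add, hN _ hw, beta_comm, hf _ hw, dbl_zero]; simp
      · rw [hw', map_add, beta_comm 1 (w - f j), hst _ hw, add_zero]
    · simp [cosetState, hw]
  ext G
  rw [h1, prod_update_apply _ _ _ fun k i => G i k]
  have h2 := cosetStateProd_update N f j (f j) G
  rw [Function.update_eq_self] at h2
  simp only [Pi.smul_apply, smul_eq_mul, h2, mul_assoc]

theorem cadd_mulVec_cosetStateProd (N : Submodule (ZMod d) (Fin (r + s) → ZMod d))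
    (f : Fin n → Fin (r + s) → ZMod d) {i j : Fin n} (hij : i ≠ j) :
    (tensorPowerMat r s (caddMat (d := d) i j)).mulVec (cosetStateProd N f) =
      cosetStateProd N (Function.update f j (f i + f j)) := by
  ext G
  have hM : ∀ G', tensorPowerMat r s (caddMat (d := d) i j) G G' =
      if G' = fun a => Function.update (G a) j (G a j - G a i) then 1 else 0 := by
    intro G'
    have h1 : ∀ a, (G a = Function.update (G' a) j (G' a i + G' a j) ↔
        G' a = Function.update (G a) j (G a j - G a i)) := by
      intro a
      constructor
      · intro h
        ext k
        by_cases hk : k = j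
        · subst hk; rw [h]; simp [Function.update_of_ne hij]
        · rw [h]; simp [Function.update_of_ne hk]
      · intro h
        ext k
        by_cases hk : k = j
        · subst hk; rw [h]; simp [Function.update_of_ne hij]
        · rw [h]; simp [Function.update_of_ne hk]
    have h2 : ∀ a : Fin (r + s), (if (a : ℕ) < r then caddMat (d := d) i j
        else (caddMat i j).map (starRingEnd ℂ)) (G a) (G' a) =
        if G' a = Function.update (G a) j (G a j - G a i) then 1 else 0 := by
      intro a
      rw [← if_congr (h1 a) rfl rfl]
      split_ifs <;> simp_all [caddMat]
    simp only [tensorPowerMat, tensorMat, Matrix.of_apply, h2]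
    rw [Finset.prod_boole]
    simp [funext_iff (f := G')]
  simp only [Matrix.mulVec, dotProduct, hM, ite_mul, one_mul, zero_mul, Finset.sum_ite_eq',
    Finset.mem_univ, if_true]
  rw [cosetStateProd_update]
  have h3 := cosetStateProd_update N f j (f j) fun a => Function.update (G a) j (G a j - G a i)
  rw [Function.update_eq_self] at h3
  rw [h3]
  have hk : ∀ k ∈ Finset.univ \ {j}, cosetState N (f k)
      (fun a => Function.update (G a) j (G a j - G a i) k) =
      cosetState N (f k) fun a => G a k := by
    intro k hk
    have : k ≠ j := by simpa using hk
    simp [Function.update_of_ne this]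
  rw [Finset.prod_congr rfl hk]
  -- If column `i` of `G` lies in `f i + N`, subtracting it from column `j` amounts to subtracting
  -- `f i` modulo `N`; otherwise factor `i` vanishes on both sides.
  by_cases hi : (fun a => G a i) - f i ∈ N
  · congr 1
    have : (fun a => Function.update (G a) j (G a j - G a i) j) - f j ∈ N ↔
        (fun a => G a j) - (f i + f j) ∈ N := by
      have e : (fun a => G a j) - (f i + f j) =
          ((fun a => Function.update (G a) j (G a j - G a i) j) - f j) +
            ((fun a => G a i) - f i) := by
        ext a; simp; ring
      rw [e, N.add_mem_iff_left hi]
    simp only [cosetState, this]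
  · rw [Finset.prod_eq_zero (i := i) (by simp [hij]) (by simp [cosetState, hi]), mul_zero, mul_zero]

end Action

/-! ### Invariance of the code spaces -/

section Invariance

open Classical

variable {d n r s : ℕ} [NeZero d]

theorem Delta_apply (U : cliffordGroup d n) (ψ : GridSpace d n (r + s)) :
    Delta d n r s U ψ =
      (tensorPowerMat r s (U : Matrix.unitaryGroup (Fin n → ZMod d) ℂ).1).mulVec ψ :=
  Matrix.toLin'_apply _ _

omit [NeZero d] in
theorem cosetStateProd_mem_codeSpace {N : Submodule (ZMod d) (Fin (r + s) → ZMod d)}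
    {f : Fin n → Fin (r + s) → ZMod d} (hf : ∀ j, f j ∈ (beta d r s).orthogonal N) :
    cosetStateProd N f ∈ codeSpace n N :=
  Submodule.subset_span ⟨f, hf, rfl⟩

omit [NeZero d] in
theorem update_mem_orthogonal {N : Submodule (ZMod d) (Fin (r + s) → ZMod d)}
    {f : Fin n → Fin (r + s) → ZMod d} (hf : ∀ j, f j ∈ (beta d r s).orthogonal N) (j : Fin n)
    {v : Fin (r + s) → ZMod d} (hv : v ∈ (beta d r s).orthogonal N) (k : Fin n) :
    Function.update f j v k ∈ (beta d r s).orthogonal N := by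
  by_cases h : k = j
  · subst h; simpa using hv
  · simpa [Function.update_of_ne h] using hf k

/-- In finite dimension an injective map sending `W` into itself sends `W` onto itself. -/
theorem _root_.Representation.le_comap_inv {G V : Type*} [Group G] [AddCommGroup V] [Module ℂ V]
    [FiniteDimensional ℂ V] (ρ : Representation ℂ G V) (W : Submodule ℂ V) {g : G}
    (h : W ≤ W.comap (ρ g)) : W ≤ W.comap (ρ g⁻¹) := by
  have hinv : ∀ v, ρ g⁻¹ (ρ g v) = v := fun v => by
    rw [← Module.End.mul_apply, ← map_mul, inv_mul_cancel, map_one, Module.End.one_apply]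
  have hinj : Function.Injective (ρ g) := Function.LeftInverse.injective hinv
  have heq : W.map (ρ g) = W :=
    Submodule.eq_of_le_of_finrank_eq (Submodule.map_le_iff_le_comap.mpr h)
      (Submodule.equivMapOfInjective _ hinj W).finrank_eq.symm
  intro v hv
  rw [← heq] at hv
  obtain ⟨w, hw, rfl⟩ := hv
  rw [Submodule.mem_comap, hinv]
  exact hw

theorem codeSpace_le_comap {N : Submodule (ZMod d) (Fin (r + s) → ZMod d)}
    (hN : IsIsotropic N) (hst : IsStochastic N) (U : cliffordGroup d n) :
    codeSpace n N ≤ (codeSpace n N).comap (Delta d n r s U) := by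
  obtain ⟨U, hU⟩ := U
  induction hU using Subgroup.closure_induction with
  | mem U h =>
    refine Submodule.span_le.mpr ?_
    rintro ψ ⟨f, hf, rfl⟩
    change Delta d n r s _ _ ∈ codeSpace n N
    rw [Delta_apply]
    obtain (⟨j, rfl⟩ | ⟨j, rfl⟩) | ⟨i, j, hij, rfl⟩ := h
    · change (tensorPowerMat r s (onQudit j (fourierMat d))).mulVec _ ∈ _
      rw [fourier_mulVec_cosetStateProd hN j (hf j)]
      exact Submodule.smul_mem _ _ (Submodule.sum_mem _ fun v _ => Submodule.smul_mem _ _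
        (cosetStateProd_mem_codeSpace (update_mem_orthogonal hf j v.2)))
    · change (tensorPowerMat r s (onQudit j (phaseMat d))).mulVec _ ∈ _
      rw [phase_mulVec_cosetStateProd hN hst j (hf j)]
      exact Submodule.smul_mem _ _ (cosetStateProd_mem_codeSpace hf)
    · change (tensorPowerMat r s (caddMat i j)).mulVec _ ∈ _
      rw [cadd_mulVec_cosetStateProd N f hij]
      exact cosetStateProd_mem_codeSpace
        (update_mem_orthogonal hf j (Submodule.add_mem _ (hf i) (hf j)))
  | one =>
    intro ψ h
    exact (congrArg (fun T => T ψ ∈ codeSpace n N) (map_one (Delta d n r s))).mpr h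
  | mul U V hU hV h1 h2 =>
    intro ψ h
    have := map_mul (Delta d n r s) ⟨U, hU⟩ ⟨V, hV⟩
    exact (congrArg (fun T => T ψ ∈ codeSpace n N) this).mpr (h1 (h2 h))
  | inv U hU h => exact (Delta d n r s).le_comap_inv (g := ⟨U, hU⟩) _ h

end Invariance

/-! ### Models of a code space -/

section Model

open Classical

variable {d n r s r' s' : ℕ} [Fact d.Prime]

/-- The sum map is injective because only `0` is sent into `N`, and both sides have dimension `k +
dim N`. -/
theorem exists_equiv_orthogonal {N : Submodule (ZMod d) (Fin (r + s) → ZMod d)}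
    (hN : IsIsotropic N) {k : ℕ} (Φ : (Fin k → ZMod d) →ₗ[ZMod d] (Fin (r + s) → ZMod d))
    (hmem : ∀ x, Φ x ∈ (beta d r s).orthogonal N) (h0 : ∀ x, Φ x ∈ N → x = 0)
    (hdim : r + s = k + 2 * Module.finrank (ZMod d) N) :
    ∃ e : (N × (Fin k → ZMod d)) ≃ (beta d r s).orthogonal N,
      ∀ p, ((e p : _) : Fin (r + s) → ZMod d) = p.1 + Φ p.2 := by
  let F : (N × (Fin k → ZMod d)) →ₗ[ZMod d] (beta d r s).orthogonal N :=
    (N.subtype.coprod Φ).codRestrict _ fun p =>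
      Submodule.add_mem _ (le_orthogonal_self hN p.1.2) (hmem p.2)
  have hF : ∀ p, ((F p : _) : Fin (r + s) → ZMod d) = p.1 + Φ p.2 := fun p => rfl
  have hinj : Function.Injective F := by
    rw [injective_iff_map_eq_zero]
    intro p hp
    have h1 : (p.1 : Fin (r + s) → ZMod d) + Φ p.2 = 0 := by rw [← hF, hp]; rfl
    have h2 : p.2 = 0 := h0 _ (by
      rw [eq_neg_of_add_eq_zero_right h1]; exact N.neg_mem p.1.2)
    rw [h2, map_zero, add_zero] at h1
    exact Prod.ext (Subtype.ext h1) h2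
  have hdim' : Module.finrank (ZMod d) (N × (Fin k → ZMod d)) =
      Module.finrank (ZMod d) ((beta d r s).orthogonal N) := by
    rw [LinearMap.BilinForm.finrank_orthogonal beta_nondegenerate, Module.finrank_prod,
      Module.finrank_fin_fun, Module.finrank_fin_fun]
    omega
  exact ⟨(LinearEquiv.ofInjectiveOfFinrankEq F hinj hdim').toEquiv, fun p => hF p⟩

/-- This serves twice: for the Fourier transform on the code and for factoring the Gauss sum over
`N^⊥`. -/
theorem sum_orthogonal_eq {N : Submodule (ZMod d) (Fin (r + s) → ZMod d)}
    (hN : IsIsotropic N) {k : ℕ} (Φ : (Fin k → ZMod d) →ₗ[ZMod d] (Fin (r + s) → ZMod d))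
    (hmem : ∀ x, Φ x ∈ (beta d r s).orthogonal N) (h0 : ∀ x, Φ x ∈ N → x = 0)
    (hdim : r + s = k + 2 * Module.finrank (ZMod d) N) {E : Type*} [AddCommGroup E]
    [Module ℂ E] (K : (Fin (r + s) → ZMod d) → E) (hK : ∀ u ∈ N, ∀ x, K (u + Φ x) = K (Φ x)) :
    ∑ v : (beta d r s).orthogonal N, K v = (Nat.card N : ℂ) • ∑ x, K (Φ x) := by
  obtain ⟨e, he⟩ := exists_equiv_orthogonal hN Φ hmem h0 hdim
  rw [← Equiv.sum_comp e fun v => K v, Fintype.sum_prod_type]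
  simp only [he]
  rw [Finset.sum_congr rfl fun (u : N) _ => Finset.sum_congr rfl fun x _ => hK _ u.property x,
    Finset.sum_const, Finset.card_univ, Nat.card_eq_fintype_card, Nat.cast_smul_eq_nsmul]

/-- An isometry from the model space of type `(r', s')` to `N^⊥` that is onto modulo `N` and
preserves the all-ones vector modulo `N`. -/
structure IsCodeModel (N : Submodule (ZMod d) (Fin (r + s) → ZMod d))
    (Φ : (Fin (r' + s') → ZMod d) →ₗ[ZMod d] (Fin (r + s) → ZMod d)) : Prop where
  beta_eq : ∀ x y, beta d r s (Φ x) (Φ y) = beta d r' s' x y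
  quad_eq : ∀ x, quad d r s (Φ x) = quad d r' s' x
  mem : ∀ x, Φ x ∈ (beta d r s).orthogonal N
  one : Φ 1 - 1 ∈ N
  dim : r + s = r' + s' + 2 * Module.finrank (ZMod d) N

namespace IsCodeModel

variable {N : Submodule (ZMod d) (Fin (r + s) → ZMod d)}
  {Φ : (Fin (r' + s') → ZMod d) →ₗ[ZMod d] (Fin (r + s) → ZMod d)}

/-- A vector of `N` pairs to zero with the image of `Φ`, and the model form is nondegenerate. -/
theorem eq_zero (h : IsCodeModel N Φ) {x : Fin (r' + s') → ZMod d} (hx : Φ x ∈ N) : x = 0 :=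
  beta_nondegenerate.1 x fun y => by rw [← h.beta_eq]; exact h.mem y _ hx

theorem beta_one (h : IsCodeModel N Φ) (x : Fin (r' + s') → ZMod d) :
    beta d r s 1 (Φ x) = beta d r' s' 1 x := by
  have := h.mem x _ h.one
  rw [map_sub, LinearMap.sub_apply, h.beta_eq, sub_eq_zero] at this
  exact this.symm

/-- The map sending a basis vector of the model to a product of coset states. -/
def toCode (n : ℕ) (N : Submodule (ZMod d) (Fin (r + s) → ZMod d))
    (Φ : (Fin (r' + s') → ZMod d) →ₗ[ZMod d] (Fin (r + s) → ZMod d)) :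
    GridSpace d n (r' + s') →ₗ[ℂ] GridSpace d n (r + s) :=
  Fintype.linearCombination ℂ fun F => cosetStateProd N fun j => Φ fun i => F i j

/-- Basis vectors are coset states of the zero subspace, so the formulas for the generators apply to
the model as well. -/
theorem cosetStateProd_bot {t : ℕ} (f : Fin n → Fin t → ZMod d) :
    cosetStateProd ⊥ f = Pi.single (fun i j => f j i) (1 : ℂ) := by
  ext G
  rw [Pi.single_apply]
  have h : ∀ j, cosetState ⊥ (f j) (fun i => G i j) = if (fun i => G i j) = f j then 1 else 0 := by
    intro j
    simp [cosetState, sub_eq_zero]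
  simp only [cosetStateProd, h, Finset.prod_boole]
  have hiff : (∀ j ∈ Finset.univ, (fun i => G i j) = f j) ↔ G = fun i j => f j i := by
    simp only [funext_iff, Finset.mem_univ, true_imp_iff]
    exact forall_comm
  by_cases hG : G = fun i j => f j i
  · rw [if_pos hG, if_pos (hiff.mpr hG)]
  · rw [if_neg hG, if_neg fun h => hG (hiff.mp h)]

theorem toCode_cosetStateProd (f : Fin n → Fin (r' + s') → ZMod d) :
    toCode n N Φ (cosetStateProd ⊥ f) = cosetStateProd N fun j => Φ (f j) := by
  rw [cosetStateProd_bot, toCode, Fintype.linearCombination_apply_single, one_smul]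

theorem linearMap_ext {t : ℕ} {E : Type*} [AddCommGroup E] [Module ℂ E]
    {A B : GridSpace d n t →ₗ[ℂ] E}
    (h : ∀ f : Fin n → Fin t → ZMod d, A (cosetStateProd ⊥ f) = B (cosetStateProd ⊥ f)) :
    A = B := by
  refine LinearMap.pi_ext fun F c => ?_
  have hF := h fun j i => F i j
  rw [cosetStateProd_bot] at hF
  have : (Pi.single F c : GridSpace d n t) = c • Pi.single F 1 := by
    rw [← Pi.single_smul, smul_eq_mul, mul_one]
  rw [this, map_smul, map_smul]
  exact congrArg (c • ·) hF

theorem cosetState_self_ne_zero {t : ℕ} (N : Submodule (ZMod d) (Fin t → ZMod d))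
    (u : Fin t → ZMod d) : cosetState N u u ≠ 0 := by
  have : 0 < Nat.card N := Nat.card_pos
  simp only [cosetState, sub_self, N.zero_mem, if_true]
  rw [ne_eq, inv_eq_zero, Complex.ofReal_eq_zero, Real.sqrt_eq_zero (Nat.cast_nonneg _)]
  exact_mod_cast this.ne'

theorem toCode_injective (h : IsCodeModel N Φ) : Function.Injective (toCode n N Φ) := by
  rw [injective_iff_map_eq_zero]
  intro ψ hψ
  ext F
  -- Evaluating at the grid `Φ F` isolates the coefficient of `F`: the other labels give different
  -- cosets of `N` in some column.
  have h1 := congrFun hψ fun i j => Φ (fun a => F a j) i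
  rw [toCode, Fintype.linearCombination_apply, Finset.sum_apply, Finset.sum_eq_single F] at h1
  · have h2 : (cosetStateProd N fun j => Φ fun i => F i j) (fun i j => Φ (fun a => F a j) i) ≠ 0 :=
      Finset.prod_ne_zero_iff.mpr fun j _ => cosetState_self_ne_zero N _
    exact (mul_eq_zero.mp h1).resolve_right h2
  · intro F' _ hF
    have : ∃ j, (fun i => F i j) ≠ fun i => F' i j := by
      by_contra! hcon
      exact hF (funext₂ fun i j => (congrFun (hcon j) i).symm)
    obtain ⟨j, hj⟩ := this
    refine mul_eq_zero_of_right _ (Finset.prod_eq_zero (Finset.mem_univ j) ?_)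
    rw [cosetState, if_neg]
    intro hmem
    have h3 : Φ ((fun i => F i j) - fun i => F' i j) ∈ N := by rw [map_sub]; exact hmem
    exact hj (sub_eq_zero.mp (h.eq_zero h3))
  · simp

theorem range_toCode (h : IsCodeModel N Φ) (hN : IsIsotropic N) :
    LinearMap.range (toCode n N Φ) = codeSpace n N := by
  apply le_antisymm
  · rintro _ ⟨ψ, rfl⟩
    rw [toCode, Fintype.linearCombination_apply]
    exact Submodule.sum_mem _ fun F _ => Submodule.smul_mem _ _
      (cosetStateProd_mem_codeSpace fun j => h.mem _)
  · refine Submodule.span_le.mpr ?_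
    rintro _ ⟨f, hf, rfl⟩
    obtain ⟨e, he⟩ := exists_equiv_orthogonal hN Φ h.mem (fun _ => h.eq_zero) h.dim
    refine ⟨cosetStateProd ⊥ fun j => (e.symm ⟨f j, hf j⟩).2, ?_⟩
    rw [toCode_cosetStateProd]
    ext G
    refine Finset.prod_congr rfl fun j _ => ?_
    have h1 := he (e.symm ⟨f j, hf j⟩)
    rw [Equiv.apply_symm_apply] at h1
    refine congrFun (cosetState_congr ?_) _
    rw [← neg_sub]
    refine N.neg_mem ?_
    change f j - _ ∈ N
    rw [show f j = _ from h1, add_sub_cancel_right]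
    exact (e.symm ⟨f j, hf j⟩).1.2

theorem isIsotropic_bot : IsIsotropic (⊥ : Submodule (ZMod d) (Fin (r' + s') → ZMod d)) := by
  intro u hu
  rw [(Submodule.mem_bot _).mp hu, quad_zero]

theorem isStochastic_bot : IsStochastic (⊥ : Submodule (ZMod d) (Fin (r' + s') → ZMod d)) := by
  simp [IsStochastic]

theorem card_eq (N : Submodule (ZMod d) (Fin (r + s) → ZMod d)) :
    Nat.card N = d ^ Module.finrank (ZMod d) N := by
  rw [Module.natCard_eq_pow_finrank (K := ZMod d), Nat.card_zmod]

/-- Each term of the model sum accounts for `|N| = d^m` terms of the sum over `N^⊥`, and `d^(-t/2)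
d^m = d^(-t'/2)` since `t = t' + 2m`. -/
theorem fourier_toCode (h : IsCodeModel N Φ) (hN : IsIsotropic N) (j : Fin n)
    (f : Fin n → Fin (r' + s') → ZMod d) :
    (tensorPowerMat r s (onQudit j (fourierMat d))).mulVec
        (toCode n N Φ (cosetStateProd ⊥ f)) =
      toCode n N Φ ((tensorPowerMat r' s' (onQudit j (fourierMat d))).mulVec
        (cosetStateProd ⊥ f)) := by
  rw [toCode_cosetStateProd, fourier_mulVec_cosetStateProd hN j (h.mem _),
    fourier_mulVec_cosetStateProd isIsotropic_bot j (by simp), map_smul, map_sum]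
  have hupd : ∀ v, (fun k => Φ (Function.update f j v k)) =
      Function.update (fun k => Φ (f k)) j (Φ v) := by
    intro v; ext1 k
    by_cases hk : k = j
    · subst hk; simp
    · simp [Function.update_of_ne hk]
  simp only [map_smul, toCode_cosetStateProd, hupd]
  rw [sum_orthogonal_eq hN Φ h.mem (fun _ => h.eq_zero) h.dim fun v => (ZMod.stdAddChar (beta d r s v (Φ (f j))) : ℂ) •
    cosetStateProd N (Function.update (fun k => Φ (f k)) j v)]
  · have hsum : ∑ x : (beta d r' s').orthogonal ⊥, (ZMod.stdAddChar (beta d r' s' x (f j)) : ℂ) •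
        cosetStateProd N (Function.update (fun k => Φ (f k)) j (Φ x)) =
        ∑ x, (ZMod.stdAddChar (beta d r' s' x (f j)) : ℂ) •
          cosetStateProd N (Function.update (fun k => Φ (f k)) j (Φ x)) :=
      Fintype.sum_equiv (Equiv.subtypeUnivEquiv fun x => by simp) _ _ fun x => rfl
    rw [hsum, smul_smul]
    simp only [h.beta_eq]
    congr 1
    have hd : (d : ℝ) ≠ 0 := Nat.cast_ne_zero.mpr (NeZero.ne d)
    have hs : ((Real.sqrt d : ℝ) : ℂ) ^ 2 = d := by
      rw [← Complex.ofReal_pow, Real.sq_sqrt (Nat.cast_nonneg d), Complex.ofReal_natCast]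
    have hs0 : ((Real.sqrt d : ℝ) : ℂ) ≠ 0 := by
      rw [Complex.ofReal_ne_zero, Real.sqrt_ne_zero (Nat.cast_nonneg d)]; exact hd
    obtain ⟨m, hm⟩ : ∃ m, m = Module.finrank (ZMod d) N := ⟨_, rfl⟩
    have hdim := h.dim
    rw [card_eq, Nat.cast_pow, ← hs, ← hm]
    rw [← hm] at hdim
    generalize r + s = t at hdim ⊢
    rw [hdim, ← pow_mul, pow_add, mul_assoc, ← mul_pow, inv_mul_cancel₀ hs0, one_pow, mul_one]
  · intro u hu x
    have h1 : beta d r s (u + Φ x) (Φ (f j)) = beta d r s (Φ x) (Φ (f j)) := by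
      rw [map_add, LinearMap.add_apply, h.mem _ _ hu, zero_add]
    rw [h1]
    congr 1
    ext G
    rw [cosetStateProd_update, cosetStateProd_update, cosetState_congr (u := u + Φ x) (v := Φ x)]
    simpa using hu

theorem Delta_toCode (h : IsCodeModel N Φ) (hN : IsIsotropic N) (hst : IsStochastic N)
    (U : cliffordGroup d n) :
    Delta d n r s U ∘ₗ toCode n N Φ = toCode n N Φ ∘ₗ Delta d n r' s' U := by
  obtain ⟨U, hU⟩ := U
  induction hU using Subgroup.closure_induction with
  | mem U hU =>
    refine linearMap_ext fun f => ?_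
    simp only [LinearMap.comp_apply, Delta_apply]
    obtain (⟨j, rfl⟩ | ⟨j, rfl⟩) | ⟨i, j, hij, rfl⟩ := hU
    · exact h.fourier_toCode hN j f
    · change (tensorPowerMat r s (onQudit j (phaseMat d))).mulVec _ =
        toCode n N Φ ((tensorPowerMat r' s' (onQudit j (phaseMat d))).mulVec _)
      rw [toCode_cosetStateProd, phase_mulVec_cosetStateProd hN hst j (h.mem _),
        phase_mulVec_cosetStateProd isIsotropic_bot isStochastic_bot j (by simp), map_smul,
        toCode_cosetStateProd, phaseExp_congr (h.quad_eq _) (h.beta_one _)]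
    · change (tensorPowerMat r s (caddMat i j)).mulVec _ =
        toCode n N Φ ((tensorPowerMat r' s' (caddMat i j)).mulVec _)
      rw [toCode_cosetStateProd, cadd_mulVec_cosetStateProd _ _ hij,
        cadd_mulVec_cosetStateProd _ _ hij, toCode_cosetStateProd]
      congr 1
      ext1 k
      by_cases hk : k = j
      · subst hk; simp
      · simp [Function.update_of_ne hk]
  | one =>
    refine LinearMap.ext fun ψ => ?_
    have h1 := congrArg (fun T => T (toCode n N Φ ψ)) (map_one (Delta d n r s))
    have h2 := congrArg (fun T => toCode n N Φ (T ψ)) (map_one (Delta d n r' s'))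
    exact h1.trans h2.symm
  | mul U V hU hV h1 h2 =>
    have e1 := map_mul (Delta d n r s) ⟨U, hU⟩ ⟨V, hV⟩
    have e2 := map_mul (Delta d n r' s') ⟨U, hU⟩ ⟨V, hV⟩
    change Delta d n r s (⟨U, hU⟩ * ⟨V, hV⟩) ∘ₗ _ = _ ∘ₗ Delta d n r' s' (⟨U, hU⟩ * ⟨V, hV⟩)
    rw [e1, e2, Module.End.mul_eq_comp, Module.End.mul_eq_comp, LinearMap.comp_assoc, h2,
      ← LinearMap.comp_assoc, h1, LinearMap.comp_assoc]
  | inv U hU h1 =>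
    have e1 := map_mul (Delta d n r s) (⟨U, hU⟩ : cliffordGroup d n)⁻¹ ⟨U, hU⟩
    have e2 := map_mul (Delta d n r' s') ⟨U, hU⟩ (⟨U, hU⟩ : cliffordGroup d n)⁻¹
    rw [inv_mul_cancel, map_one, Module.End.mul_eq_comp, Module.End.one_eq_id] at e1
    rw [mul_inv_cancel, map_one, Module.End.mul_eq_comp, Module.End.one_eq_id] at e2
    change Delta d n r s (⟨U, hU⟩ : cliffordGroup d n)⁻¹ ∘ₗ _ =
      _ ∘ₗ Delta d n r' s' (⟨U, hU⟩ : cliffordGroup d n)⁻¹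
    calc _ = Delta d n r s (⟨U, hU⟩ : cliffordGroup d n)⁻¹ ∘ₗ (toCode n N Φ ∘ₗ
          Delta d n r' s' ⟨U, hU⟩) ∘ₗ Delta d n r' s' (⟨U, hU⟩ : cliffordGroup d n)⁻¹ := by
          rw [LinearMap.comp_assoc, ← e2, LinearMap.comp_id]
      _ = _ := by
          rw [← h1, ← LinearMap.comp_assoc, ← LinearMap.comp_assoc, ← e1, LinearMap.id_comp]

theorem nonempty_equiv (h : IsCodeModel N Φ) (hN : IsIsotropic N) (hst : IsStochastic N)
    (hinv : ∀ U, codeSpace n N ≤ (codeSpace n N).comap (Delta d n r s U)) :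
    Nonempty (Representation.Equiv
      ((Delta d n r s).subrepresentation (codeSpace n N) hinv) (Delta d n r' s')) := by
  let e : GridSpace d n (r' + s') ≃ₗ[ℂ] codeSpace n N :=
    (LinearEquiv.ofInjective _ (h.toCode_injective (n := n))).trans
      (LinearEquiv.ofEq _ _ (h.range_toCode hN))
  refine ⟨(Representation.Equiv.mk e fun U => ?_).symm⟩
  refine LinearMap.ext fun ψ => Subtype.ext ?_
  exact (LinearMap.congr_fun (h.Delta_toCode hN hst U) ψ).symm

end IsCodeModel

end Model

/-! ### Degenerate symmetric bilinear spaces -/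

section Bilinear

variable {K T : Type*} [Field K] [AddCommGroup T] [Module K T]
  {B : LinearMap.BilinForm K T}

/-- `N` is the radical of the restriction of `B` to `W`. -/
def IsRadical (B : LinearMap.BilinForm K T) (W N : Submodule K T) : Prop :=
  ∀ x, x ∈ N ↔ x ∈ W ∧ ∀ y ∈ W, B x y = 0

theorem mem_cut {W : Submodule K T} {v x : T} :
    x ∈ W ⊓ LinearMap.ker (B v) ↔ x ∈ W ∧ B v x = 0 := by
  rw [Submodule.mem_inf, LinearMap.mem_ker]

theorem sub_proj_mem_cut {W : Submodule K T} {v x : T} (hv : v ∈ W) (hvv : B v v ≠ 0)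
    (hx : x ∈ W) : x - (B v x / B v v) • v ∈ W ⊓ LinearMap.ker (B v) := by
  refine mem_cut.mpr ⟨W.sub_mem hx (W.smul_mem _ hv), ?_⟩
  rw [map_sub, map_smul, smul_eq_mul, div_mul_cancel₀ _ hvv, sub_self]

/-- Splitting off an anisotropic vector leaves the radical unchanged. This drives the inductions on
dimension without passing to the quotient `W / N`. -/
theorem IsRadical.cut (hsymm : ∀ u v, B u v = B v u) {W N : Submodule K T}
    (h : IsRadical B W N) {v : T} (hv : v ∈ W) (hvv : B v v ≠ 0) :
    IsRadical B (W ⊓ LinearMap.ker (B v)) N := by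
  intro x
  constructor
  · intro hx
    obtain ⟨h1, h2⟩ := (h x).mp hx
    exact ⟨mem_cut.mpr ⟨h1, by rw [hsymm]; exact h2 v hv⟩, fun y hy => h2 y hy.1⟩
  · rintro ⟨h1, h2⟩
    refine (h x).mpr ⟨h1.1, fun y hy => ?_⟩
    have h3 := h2 _ (sub_proj_mem_cut hv hvv hy)
    rw [map_sub, map_smul, hsymm x v, (mem_cut.mp h1).2, smul_zero, sub_zero] at h3
    exact h3

theorem finrank_cut [FiniteDimensional K T] {W : Submodule K T} {v : T} (hv : v ∈ W)
    (hvv : B v v ≠ 0) :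
    Module.finrank K (W ⊓ LinearMap.ker (B v) : Submodule K T) + 1 = Module.finrank K W := by
  have hv0 : v ≠ 0 := by rintro rfl; simp at hvv
  have hsup : (W ⊓ LinearMap.ker (B v)) ⊔ K ∙ v = W := by
    apply le_antisymm
    · exact sup_le inf_le_left ((Submodule.span_singleton_le_iff_mem _ _).mpr hv)
    · intro x hx
      rw [← sub_add_cancel x ((B v x / B v v) • v)]
      exact Submodule.add_mem_sup (sub_proj_mem_cut hv hvv hx)
        (Submodule.smul_mem _ _ (Submodule.mem_span_singleton_self v))
  have hinf : (W ⊓ LinearMap.ker (B v)) ⊓ K ∙ v = ⊥ := by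
    rw [Submodule.eq_bot_iff]
    rintro x ⟨h1, h2⟩
    obtain ⟨c, rfl⟩ := Submodule.mem_span_singleton.mp h2
    have h3 := (mem_cut.mp h1).2
    rw [map_smul, smul_eq_mul] at h3
    rw [(mul_eq_zero.mp h3).resolve_right hvv, zero_smul]
  have := Submodule.finrank_sup_add_finrank_inf_eq (W ⊓ LinearMap.ker (B v)) (K ∙ v)
  rw [hsup, hinf, finrank_bot, finrank_span_singleton hv0] at this
  omega

theorem IsRadical.exists_apply_ne_zero {W N : Submodule K T} (h : IsRadical B W N) {x : T}
    (hx : x ∈ W) (hxN : x ∉ N) : ∃ y ∈ W, B x y ≠ 0 := by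
  by_contra! hcon
  exact hxN ((h x).mpr ⟨hx, hcon⟩)

theorem IsRadical.exists_mem_notMem [FiniteDimensional K T] {W N : Submodule K T}
    (hlt : Module.finrank K N < Module.finrank K W) : ∃ x ∈ W, x ∉ N := by
  by_contra! hcon
  exact absurd (Submodule.finrank_mono (show W ≤ N from hcon)) (by omega)

theorem IsRadical.exists_anisotropic [FiniteDimensional K T] (h2 : (2 : K) ≠ 0)
    (hsymm : ∀ u v, B u v = B v u) {W N : Submodule K T} (h : IsRadical B W N)
    (hlt : Module.finrank K N < Module.finrank K W) : ∃ v ∈ W, B v v ≠ 0 := by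
  obtain ⟨x, hx, hxN⟩ := exists_mem_notMem hlt
  obtain ⟨y, hy, hxy⟩ := h.exists_apply_ne_zero hx hxN
  by_contra! hcon
  have h3 := hcon _ (W.add_mem hx hy)
  simp only [map_add, LinearMap.add_apply, hcon x hx, hcon y hy, hsymm y x, zero_add,
    add_zero] at h3
  rw [← two_mul] at h3
  exact hxy ((mul_eq_zero.mp h3).resolve_left h2)

theorem exists_mul_sq_add_mul_sq [Fintype K] (hK : Fintype.card K % 2 = 1) {a b : K}
    (ha : a ≠ 0) (hb : b ≠ 0) (c : K) : ∃ x y, a * x ^ 2 + b * y ^ 2 = c := by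
  obtain ⟨x, y, h⟩ := FiniteField.exists_root_sum_quadratic (R := K)
    (f := Polynomial.C a * Polynomial.X ^ 2)
    (g := Polynomial.C b * Polynomial.X ^ 2 - Polynomial.C c)
    (by exact Polynomial.degree_C_mul_X_pow 2 ha)
    (by
      rw [Polynomial.degree_sub_eq_left_of_degree_lt] <;> rw [Polynomial.degree_C_mul_X_pow 2 hb]
      · rfl
      · exact lt_of_le_of_lt Polynomial.degree_C_le (by norm_num))
    hK
  refine ⟨x, y, ?_⟩
  simp only [Polynomial.eval_mul, Polynomial.eval_C, Polynomial.eval_pow, Polynomial.eval_X,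
    Polynomial.eval_sub] at h
  linear_combination h

/-- Rank at least two gives two orthogonal anisotropic vectors, and a nondegenerate binary form over
a finite field of odd order is universal. -/
theorem IsRadical.exists_represents [FiniteDimensional K T] [Fintype K]
    (hK : Fintype.card K % 2 = 1) (h2 : (2 : K) ≠ 0) (hsymm : ∀ u v, B u v = B v u)
    {W N : Submodule K T} (h : IsRadical B W N)
    (hlt : Module.finrank K N + 2 ≤ Module.finrank K W) (c : K) : ∃ v ∈ W, B v v = c := by
  obtain ⟨v, hv, hvv⟩ := h.exists_anisotropic h2 hsymm (by omega)
  have hcut := finrank_cut hv hvv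
  obtain ⟨u, hu, huu⟩ := (h.cut hsymm hv hvv).exists_anisotropic h2 hsymm (by omega)
  obtain ⟨x, y, hxy⟩ := exists_mul_sq_add_mul_sq hK hvv huu c
  refine ⟨x • v + y • u, W.add_mem (W.smul_mem _ hv) (W.smul_mem _ hu.1), ?_⟩
  have hvu := (mem_cut.mp hu).2
  simp only [map_add, map_smul, LinearMap.add_apply, LinearMap.smul_apply, smul_eq_mul,
    hsymm u v, hvu, mul_zero, add_zero, zero_add]
  linear_combination hxy

/-- An orthogonal family in `W`. -/
structure IsOrthoFamily (B : LinearMap.BilinForm K T) (W : Submodule K T) {k : ℕ}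
    (φ : Fin k → T) : Prop where
  mem : ∀ i, φ i ∈ W
  ortho : ∀ i j, i ≠ j → B (φ i) (φ j) = 0

theorem IsOrthoFamily.cons (hsymm : ∀ u v, B u v = B v u) {W : Submodule K T} {k : ℕ}
    {φ : Fin k → T} {v : T} (hv : v ∈ W)
    (h : IsOrthoFamily B (W ⊓ LinearMap.ker (B v)) φ) :
    IsOrthoFamily B W (Fin.cons v φ : Fin (k + 1) → T) where
  mem := Fin.cases hv fun i => (h.mem i).1
  ortho := by
    intro i j
    refine Fin.cases ?_ (fun i => ?_) i <;> refine Fin.cases ?_ (fun j => ?_) j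
    · intro h; exact absurd rfl h
    · intro _; exact (mem_cut.mp (h.mem j)).2
    · intro _; rw [hsymm]; exact (mem_cut.mp (h.mem i)).2
    · intro hij; exact h.ortho i j fun e => hij (congrArg _ e)

/-- Norms are prescribed one at a time while the remaining rank is at least two. At rank one the
norm is determined up to squares, so the last one is only nonzero. -/
theorem IsRadical.exists_orthoFamily [FiniteDimensional K T] [Fintype K]
    (hK : Fintype.card K % 2 = 1) (h2 : (2 : K) ≠ 0) (hsymm : ∀ u v, B u v = B v u)
    {N : Submodule K T} (k : ℕ) :
    ∀ {W : Submodule K T} (_ : IsRadical B W N)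
      (_ : Module.finrank K W = Module.finrank K N + (k + 1)) (w : Fin (k + 1) → K)
      (_ : ∀ i, w i ≠ 0),
      ∃ φ : Fin (k + 1) → T, IsOrthoFamily B W φ ∧
        (∀ i, i ≠ Fin.last k → B (φ i) (φ i) = w i) ∧ B (φ (Fin.last k)) (φ (Fin.last k)) ≠ 0 := by
  induction k with
  | zero =>
    intro W h hdim w _
    obtain ⟨v, hv, hvv⟩ := h.exists_anisotropic h2 hsymm (by omega)
    exact ⟨fun _ => v, ⟨fun _ => hv, fun i j hij => absurd (Subsingleton.elim (α := Fin 1) i j) hij⟩,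
      fun i hi => absurd (Subsingleton.elim (α := Fin 1) i _) hi, hvv⟩
  | succ k ih =>
    intro W h hdim w hw
    obtain ⟨v, hv, hvv⟩ := h.exists_represents hK h2 hsymm (by omega) (w 0)
    have hvv0 : B v v ≠ 0 := hvv ▸ hw 0
    have hcut := finrank_cut hv hvv0
    obtain ⟨φ, h1, h3, h4⟩ := ih (h.cut hsymm hv hvv0) (by omega) (fun i => w i.succ)
      fun i => hw _
    refine ⟨Fin.cons v φ, h1.cons hsymm hv, ?_, h4⟩
    intro i
    refine Fin.cases (fun _ => hvv) (fun i hi => ?_) i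
    exact h3 i fun e => hi (by rw [e, Fin.succ_last])

/-- `σ` is a `B`-isometry preserving `W`. -/
structure IsIsometryOf (B : LinearMap.BilinForm K T) (W : Submodule K T) (σ : T →ₗ[K] T) :
    Prop where
  apply_eq : ∀ x y, B (σ x) (σ y) = B x y
  mem : ∀ x ∈ W, σ x ∈ W

theorem IsIsometryOf.comp {W : Submodule K T} {σ τ : T →ₗ[K] T} (hσ : IsIsometryOf B W σ)
    (hτ : IsIsometryOf B W τ) : IsIsometryOf B W (σ ∘ₗ τ) where
  apply_eq x y := by simp only [LinearMap.comp_apply, hσ.apply_eq, hτ.apply_eq]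
  mem x hx := hσ.mem _ (hτ.mem _ hx)

theorem IsIsometryOf.neg {W : Submodule K T} {σ : T →ₗ[K] T} (hσ : IsIsometryOf B W σ) :
    IsIsometryOf B W (-σ) where
  apply_eq x y := by simp [hσ.apply_eq]
  mem x hx := W.neg_mem (hσ.mem _ hx)

/-- A reflection exchanges two vectors of equal norm whose difference is anisotropic. -/
theorem exists_reflection (hsymm : ∀ u v, B u v = B v u) {W : Submodule K T} {x y : T}
    (hx : x ∈ W) (hy : y ∈ W) (hxy : B x x = B y y) (hne : B (x - y) (x - y) ≠ 0) :
    ∃ σ : T →ₗ[K] T, IsIsometryOf B W σ ∧ σ x = y := by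
  obtain ⟨v, hv⟩ : ∃ v, v = x - y := ⟨_, rfl⟩
  rw [← hv] at hne
  have hvW : v ∈ W := hv ▸ W.sub_mem hx hy
  have happ : ∀ z, (LinearMap.id - (B v).smulRight ((2 / B v v) • v) : T →ₗ[K] T) z =
      z - (2 * B v z / B v v) • v := by
    intro z
    simp only [LinearMap.sub_apply, LinearMap.id_apply, LinearMap.smulRight_apply, smul_smul]
    congr 2; ring
  refine ⟨LinearMap.id - (B v).smulRight ((2 / B v v) • v), ⟨fun a b => ?_, fun z hz => ?_⟩, ?_⟩
  · rw [happ, happ]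
    simp only [map_sub, map_smul, LinearMap.sub_apply, LinearMap.smul_apply, smul_eq_mul,
      hsymm a v]
    field_simp
    ring
  · rw [happ]; exact W.sub_mem hz (W.smul_mem _ hvW)
  · rw [happ]
    have h1 : 2 * B v x = B v v := by
      rw [hv]
      simp only [map_sub, LinearMap.sub_apply, hsymm y x]
      linear_combination hxy
    rw [h1, div_self hne, one_smul, hv, sub_sub_cancel]

/-- Witt's extension theorem for a single vector. -/
theorem IsRadical.exists_isometry (h2 : (2 : K) ≠ 0) (hsymm : ∀ u v, B u v = B v u)
    {W N : Submodule K T} (h : IsRadical B W N) {x y : T} (hx : x ∈ W) (hy : y ∈ W)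
    (hxN : x ∉ N) (hyN : y ∉ N) (hxy : B x x = B y y) :
    ∃ σ : T →ₗ[K] T, IsIsometryOf B W σ ∧ σ x = y := by
  by_cases h1 : B (x - y) (x - y) = 0
  · have h3 : B x x = B x y := by
      simp only [map_sub, LinearMap.sub_apply, hsymm y x] at h1
      have : 2 * (B x x - B x y) = 0 := by linear_combination h1 + hxy
      exact sub_eq_zero.mp ((mul_eq_zero.mp this).resolve_left h2)
    by_cases h0 : B x x = 0
    -- Here `x` and `y` are isotropic and orthogonal, so no single reflection works; two reflections
    -- pass through an isotropic `z` orthogonal to neither.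
    · obtain ⟨z, hz, hz0, hxz, hyz⟩ : ∃ z ∈ W, B z z = 0 ∧ B x z ≠ 0 ∧ B y z ≠ 0 := by
        obtain ⟨z, hz, hxz, hyz⟩ : ∃ z ∈ W, B x z ≠ 0 ∧ B y z ≠ 0 := by
          obtain ⟨a, ha, hxa⟩ := h.exists_apply_ne_zero hx hxN
          obtain ⟨b, hb, hyb⟩ := h.exists_apply_ne_zero hy hyN
          by_cases hya : B y a = 0
          · by_cases hxb : B x b = 0
            · exact ⟨a + b, W.add_mem ha hb, by simpa [hxb], by simpa [hya]⟩
            · exact ⟨b, hb, hxb, hyb⟩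
          · exact ⟨a, ha, hxa, hya⟩
        -- The multiple of `x` cancels the norm of `z` and leaves its pairings with `x` and `y`
        -- unchanged.
        refine ⟨z + (-(B z z) / (2 * B x z)) • x, W.add_mem hz (W.smul_mem _ hx), ?_, ?_, ?_⟩
        · simp only [map_add, map_smul, LinearMap.add_apply, LinearMap.smul_apply, smul_eq_mul,
            h0, hsymm z x]
          field_simp
          ring
        · simpa [h0] using hxz
        · simpa [hsymm y x, ← h3, h0] using hyz
      obtain ⟨σ, hσ, hσx⟩ := exists_reflection hsymm hx hz (h0.trans hz0.symm) (by
        simp only [map_sub, LinearMap.sub_apply, hsymm z x, h0, hz0]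
        intro h; apply hxz
        have : 2 * B x z = 0 := by linear_combination -h
        exact (mul_eq_zero.mp this).resolve_left h2)
      obtain ⟨τ, hτ, hτz⟩ := exists_reflection hsymm hz hy (hz0.trans (h0.symm.trans hxy)) (by
        simp only [map_sub, LinearMap.sub_apply, hsymm z y, ← hxy, h0, hz0]
        intro h; apply hyz
        have : 2 * B y z = 0 := by linear_combination -h
        exact (mul_eq_zero.mp this).resolve_left h2)
      exact ⟨τ ∘ₗ σ, hτ.comp hσ, by rw [LinearMap.comp_apply, hσx, hτz]⟩
    -- Now `x + y` has norm `4 B x x ≠ 0`, so a reflection takes `x` to `-y`; its negative is the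
    -- required isometry.
    · obtain ⟨σ, hσ, hσx⟩ := exists_reflection (y := -y) hsymm hx (W.neg_mem hy)
        (by simpa using hxy) (by
          simp only [sub_neg_eq_add, map_add, LinearMap.add_apply, hsymm y x, ← h3, ← hxy]
          intro h; apply h0
          have : 2 * (2 * B x x) = 0 := by linear_combination h
          exact (mul_eq_zero.mp ((mul_eq_zero.mp this).resolve_left h2)).resolve_left h2)
      exact ⟨-σ, hσ.neg, by rw [LinearMap.neg_apply, hσx, neg_neg]⟩
  · exact exists_reflection hsymm hx hy hxy h1

end Bilinear

/-! ### Gauss sums -/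

section FieldGauss

variable {F : Type*} [Field F] [Fintype F] [DecidableEq F]

/-- The quadratic character with complex values. -/
def quadChar (F : Type*) [Field F] [Fintype F] [DecidableEq F] : MulChar F ℂ :=
  (quadraticChar F).ringHomComp (Int.castRingHom ℂ)

theorem quadChar_sq {a : F} (ha : a ≠ 0) : quadChar F a * quadChar F a = 1 := by
  have h := quadraticChar_sq_one ha
  rw [pow_two] at h
  simp only [quadChar, MulChar.ringHomComp_apply, ← map_mul, h, map_one]

/-- An element `y` has `1 + χ(y)` square roots, and the constant 1 contributes nothing because `ψ`
is primitive. -/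
theorem sum_addChar_mul_sq (hF : ringChar F ≠ 2) {ψ : AddChar F ℂ} (hψ : ψ.IsPrimitive) {a : F}
    (ha : a ≠ 0) : ∑ x, ψ (a * x ^ 2) = quadChar F a * gaussSum (quadChar F) ψ := by
  have h1 : ∑ x, ψ (a * x ^ 2) = ∑ y, (quadChar F y + 1) * ψ (a * y) := by
    rw [← Finset.sum_fiberwise' Finset.univ (fun x : F => x ^ 2) fun y => ψ (a * y)]
    refine Finset.sum_congr rfl fun y _ => ?_
    rw [Finset.sum_const, nsmul_eq_mul]
    congr 1
    have h2 := quadraticChar_card_sqrts hF y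
    rw [Set.toFinset_ofPred] at h2
    have h3 := congrArg (Int.cast : ℤ → ℂ) h2
    push_cast at h3
    exact h3
  have h4 : ∑ y, ψ (a * y) = 0 := by
    have := AddChar.sum_mulShift a hψ
    rw [if_neg ha, Nat.cast_zero] at this
    rw [← this]
    exact Finset.sum_congr rfl fun y _ => by rw [mul_comm]
  have h5 := gaussSum_mulShift (quadChar F) ψ (Units.mk0 a ha)
  simp only [add_mul, one_mul, Finset.sum_add_distrib, h4, add_zero] at h1
  rw [h1, ← h5, ← mul_assoc, Units.val_mk0, quadChar_sq ha, one_mul]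
  rfl

theorem gaussSum_quadChar_ne_zero (hF : ringChar F ≠ 2) {ψ : AddChar F ℂ} (hψ : ψ.IsPrimitive) :
    gaussSum (quadChar F) ψ ≠ 0 := by
  refine gaussSum_ne_zero_of_nontrivial (Nat.cast_ne_zero.mpr Fintype.card_ne_zero) ?_ hψ
  exact (MulChar.ringHomComp_ne_one_iff (RingHom.injective_int _)).mpr (quadraticChar_ne_one hF)

/-- The Gauss sum is nonzero, so equal sums force `χ(a) = χ(b)`: the sum detects the square class.
-/
theorem exists_eq_mul_sq_of_sum_eq (hF : ringChar F ≠ 2) {ψ : AddChar F ℂ} (hψ : ψ.IsPrimitive)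
    {a b : F} (ha : a ≠ 0) (hb : b ≠ 0) (h : ∑ x, ψ (a * x ^ 2) = ∑ x, ψ (b * x ^ 2)) :
    ∃ c, c ≠ 0 ∧ a = b * c ^ 2 := by
  rw [sum_addChar_mul_sq hF hψ ha, sum_addChar_mul_sq hF hψ hb] at h
  have h1 := mul_right_cancel₀ (gaussSum_quadChar_ne_zero hF hψ) h
  have h2 : quadraticChar F a = quadraticChar F b := by
    simp only [quadChar, MulChar.ringHomComp_apply] at h1
    exact (RingHom.injective_int (Int.castRingHom ℂ)) h1
  have h3 : quadraticChar F (a * b) = 1 := by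
    rw [map_mul, h2, ← pow_two, quadraticChar_sq_one hb]
  obtain ⟨c, hc⟩ := (quadraticChar_one_iff_isSquare (mul_ne_zero ha hb)).mp h3
  have hc0 : c ≠ 0 := by rintro rfl; exact mul_ne_zero ha hb (by simpa using hc)
  refine ⟨c / b, div_ne_zero hc0 hb, ?_⟩
  field_simp
  linear_combination hc

end FieldGauss

/-! ### Gauss sums of the quadratic form on `T` and on `N^⊥`. -/

section QuadGauss

open Classical

variable {d r s : ℕ}

/-- The one-dimensional Gauss sum `∑ τ^{a x²}`. -/
def quadGauss (d : ℕ) [NeZero d] (a : ZMod (bigD d)) : ℂ := ∑ x : ZMod d, tauChar d (a * sq x)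

/-- Substituting `x = y + z` turns the product into a double sum of `τ^(z²) ω^(yz)`, and the sum
over `y` kills every `z ≠ 0`. -/
theorem quadGauss_one_mul_neg_one [NeZero d] :
    quadGauss d 1 * quadGauss d (-1) = d := by
  have h1 : ∀ y : ZMod d, ∑ x : ZMod d, tauChar d (1 * sq x) * tauChar d (-1 * sq y) =
      ∑ z, tauChar d (sq z) * ZMod.stdAddChar (y * z) := by
    intro y
    refine (Fintype.sum_equiv (Equiv.addLeft y) _ _ fun z => ?_).symm
    rw [Equiv.coe_addLeft, sq_add, ← tauChar_dbl, ← AddChar.map_add_eq_mul,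
      ← AddChar.map_add_eq_mul]
    congr 1; ring
  rw [quadGauss, quadGauss, Finset.sum_mul_sum, Finset.sum_comm,
    Finset.sum_congr rfl fun y _ => h1 y, Finset.sum_comm]
  simp only [← Finset.mul_sum]
  rw [Finset.sum_congr rfl fun z _ => congrArg _ (AddChar.sum_mulShift z
    (ZMod.isPrimitive_stdAddChar d))]
  simp [sq_zero, ZMod.card]

theorem sum_tauChar_quad [NeZero d] :
    ∑ u, tauChar d (quad d r s u) = quadGauss d 1 ^ r * quadGauss d (-1) ^ s := by
  simp only [quad_eq_sum, addChar_map_sum]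
  have h := Finset.prod_univ_sum (fun _ : Fin (r + s) => (Finset.univ : Finset (ZMod d)))
    fun i x => tauChar d ((sgn r s i : ZMod (bigD d)) * sq x)
  rw [Fintype.piFinset_univ] at h
  rw [← h, Fin.prod_univ_add]
  congr 1
  · refine (Finset.prod_congr rfl fun i _ => ?_).trans (by rw [Finset.prod_const, Finset.card_univ,
      Fintype.card_fin])
    simp [quadGauss, sgn]
  · refine (Finset.prod_congr rfl fun i _ => ?_).trans (by rw [Finset.prod_const, Finset.card_univ,
      Fintype.card_fin])
    simp [quadGauss, sgn]

variable [Fact d.Prime]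

/-- Average the sum over translations by `N`: a translation by `u` multiplies the term at `x` by
`ω^(β(x, u))`, so only `x ∈ N^⊥` survives. -/
theorem sum_tauChar_quad_orthogonal {N : Submodule (ZMod d) (Fin (r + s) → ZMod d)}
    (hN : IsIsotropic N) :
    ∑ v : (beta d r s).orthogonal N, tauChar d (quad d r s v) =
      ∑ u, tauChar d (quad d r s u) := by
  have hc : (Nat.card N : ℂ) ≠ 0 := Nat.cast_ne_zero.mpr Nat.card_pos.ne'
  apply mul_left_cancel₀ hc
  rw [← sum_ite_mem_submodule _ fun v => tauChar d (quad d r s v)]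
  have h1 : ∀ x, ∑ u : N, tauChar d (quad d r s (x + u)) = (Nat.card N : ℂ) *
      if x ∈ (beta d r s).orthogonal N then tauChar d (quad d r s x) else 0 := by
    intro x
    have h2 : ∀ u : N, tauChar d (quad d r s (x + u)) =
        tauChar d (quad d r s x) * ZMod.stdAddChar (beta d r s x u) := by
      intro u
      rw [quad_add, hN u u.2, add_zero, AddChar.map_add_eq_mul, tauChar_dbl]
    rw [Finset.sum_congr rfl fun u _ => h2 u, ← Finset.mul_sum, sum_stdAddChar_beta]
    split_ifs <;> ring
  have h3 : ∀ u : N, ∑ x, tauChar d (quad d r s (x + u)) = ∑ x, tauChar d (quad d r s x) :=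
    fun u => Equiv.sum_comp (Equiv.addRight u.1) fun x => tauChar d (quad d r s x)
  rw [Finset.mul_sum, ← Finset.sum_congr rfl fun x _ => h1 x, Finset.sum_comm,
    Finset.sum_congr rfl fun u _ => h3 u, Finset.sum_const, Finset.card_univ,
    Nat.card_eq_fintype_card, nsmul_eq_mul]

theorem isRadical_orthogonal {N : Submodule (ZMod d) (Fin (r + s) → ZMod d)}
    (hN : IsIsotropic N) : IsRadical (beta d r s) ((beta d r s).orthogonal N) N := by
  intro x
  constructor
  · intro hx
    exact ⟨le_orthogonal_self hN hx, fun y hy => hy x hx⟩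
  · rintro ⟨-, h⟩
    rw [← LinearMap.BilinForm.orthogonal_orthogonal beta_nondegenerate beta_isRefl N]
    intro y hy
    rw [beta_comm]
    exact h y hy

theorem finrank_orthogonal_eq {N : Submodule (ZMod d) (Fin (r + s) → ZMod d)}
    (hN : IsIsotropic N) : 2 * Module.finrank (ZMod d) N ≤ r + s ∧
      Module.finrank (ZMod d) ((beta d r s).orthogonal N) =
        Module.finrank (ZMod d) N + (r + s - 2 * Module.finrank (ZMod d) N) := by
  have h1 := LinearMap.BilinForm.finrank_orthogonal beta_nondegenerate N (B := beta d r s)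
  have h2 := Submodule.finrank_mono (le_orthogonal_self hN)
  have h3 := Submodule.finrank_le N
  rw [Module.finrank_fin_fun] at h1 h3
  omega

theorem beta_linearCombination {W : Submodule (ZMod d) (Fin (r + s) → ZMod d)} {k : ℕ}
    {φ : Fin k → Fin (r + s) → ZMod d} (hφ : IsOrthoFamily (beta d r s) W φ) (x : Fin k → ZMod d)
    (j : Fin k) :
    beta d r s (Fintype.linearCombination (ZMod d) φ x) (φ j) =
      x j * beta d r s (φ j) (φ j) := by
  rw [Fintype.linearCombination_apply, map_sum, LinearMap.sum_apply, Finset.sum_eq_single j]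
  · simp
  · intro i _ hij; simp [hφ.ortho i j hij]
  · simp

theorem linearCombination_mem {W : Submodule (ZMod d) (Fin (r + s) → ZMod d)} {k : ℕ}
    {φ : Fin k → Fin (r + s) → ZMod d} (hφ : IsOrthoFamily (beta d r s) W φ) (x : Fin k → ZMod d) :
    Fintype.linearCombination (ZMod d) φ x ∈ W := by
  rw [Fintype.linearCombination_apply]
  exact Submodule.sum_mem _ fun i _ => Submodule.smul_mem _ _ (hφ.mem i)

theorem eq_zero_of_linearCombination_mem {N : Submodule (ZMod d) (Fin (r + s) → ZMod d)} {k : ℕ}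
    {φ : Fin k → Fin (r + s) → ZMod d}
    (hφ : IsOrthoFamily (beta d r s) ((beta d r s).orthogonal N) φ)
    (hφ0 : ∀ i, beta d r s (φ i) (φ i) ≠ 0) {x : Fin k → ZMod d}
    (hx : Fintype.linearCombination (ZMod d) φ x ∈ N) : x = 0 := by
  ext j
  have h1 := hφ.mem j _ hx
  rw [beta_linearCombination hφ] at h1
  exact (mul_eq_zero.mp h1).resolve_right (hφ0 j)

theorem prod_quadGauss {N : Submodule (ZMod d) (Fin (r + s) → ZMod d)}
    (hN : IsIsotropic N) {k : ℕ} (hk : r + s = k + 2 * Module.finrank (ZMod d) N)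
    {φ : Fin k → Fin (r + s) → ZMod d}
    (hφ : IsOrthoFamily (beta d r s) ((beta d r s).orthogonal N) φ)
    (hφ0 : ∀ i, beta d r s (φ i) (φ i) ≠ 0) :
    quadGauss d 1 ^ r * quadGauss d (-1) ^ s =
      (d : ℂ) ^ Module.finrank (ZMod d) N * ∏ i, quadGauss d (quad d r s (φ i)) := by
  have hmem := linearCombination_mem hφ
  have h0 := fun x => eq_zero_of_linearCombination_mem hφ hφ0 (x := x)
  rw [← sum_tauChar_quad, ← sum_tauChar_quad_orthogonal hN,
    sum_orthogonal_eq hN _ hmem h0 hk fun v => tauChar d (quad d r s v)]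
  · rw [IsCodeModel.card_eq, smul_eq_mul, Nat.cast_pow]
    congr 1
    simp only [Fintype.linearCombination_apply, quad_sum φ hφ.ortho, addChar_map_sum, quadGauss]
    rw [Finset.prod_univ_sum, Fintype.piFinset_univ]
    simp only [mul_comm (sq _)]
  · intro u hu x
    rw [quad_add, hN u hu, hmem x u hu, dbl_zero, zero_add, add_zero]

theorem isCodeModel_of_family {r' s' : ℕ} {N : Submodule (ZMod d) (Fin (r + s) → ZMod d)}
    (hdim : r + s = r' + s' + 2 * Module.finrank (ZMod d) N)
    {φ : Fin (r' + s') → Fin (r + s) → ZMod d}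
    (hφ : IsOrthoFamily (beta d r s) ((beta d r s).orthogonal N) φ)
    (hq : ∀ i, quad d r s (φ i) = sgn r' s' i) (hone : ∑ i, φ i - 1 ∈ N) :
    IsCodeModel N (Fintype.linearCombination (ZMod d) φ) := by
  have hb : ∀ i, beta d r s (φ i) (φ i) = sgn r' s' i := by
    intro i
    apply dbl_injective
    rw [dbl_beta_self, hq, dbl_intCast]
  refine ⟨fun x y => ?_, fun x => ?_, fun x => ?_, ?_, hdim⟩
  · rw [Fintype.linearCombination_apply _ _ y, map_sum, beta_apply x y]
    refine Finset.sum_congr rfl fun i _ => ?_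
    rw [map_smul, beta_linearCombination hφ, hb, smul_eq_mul]
    ring
  · rw [Fintype.linearCombination_apply, quad_sum φ hφ.ortho, quad_eq_sum]
    simp only [hq, mul_comm (sq _)]
  · exact linearCombination_mem hφ x
  · simpa [Fintype.linearCombination_apply] using hone

end QuadGauss

/-! ### Models of codes in odd characteristic -/

section Odd

variable {d r s : ℕ} [Fact d.Prime]

theorem not_even_of_ne_two (hd : d ≠ 2) : ¬ Even d :=
  fun h => hd (((Fact.out : d.Prime).even_iff).mp h)

/-- For odd `d`, the identification of `ℤ/D` with `ℤ/d`. -/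
def oddEquiv (hd : ¬ Even d) : ZMod (bigD d) ≃+* ZMod d := ZMod.ringEquivCongr (if_neg hd)

theorem two_ne_zero_of_not_even (hd : ¬ Even d) : (2 : ZMod d) ≠ 0 := by
  have := (isUnit_two_of_not_even hd).map (oddEquiv hd)
  rw [map_ofNat] at this
  exact this.ne_zero

theorem oddEquiv_dbl (hd : ¬ Even d) (x : ZMod d) : oddEquiv hd (dbl x) = 2 * x := by
  rw [dbl, map_mul, map_ofNat, map_natCast, ZMod.natCast_zmod_val]

theorem oddEquiv_sq (hd : ¬ Even d) (x : ZMod d) : oddEquiv hd (sq x) = x ^ 2 := by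
  rw [sq, map_pow, map_natCast, ZMod.natCast_zmod_val]

theorem oddEquiv_quad (hd : ¬ Even d) (u : Fin (r + s) → ZMod d) :
    oddEquiv hd (quad d r s u) = beta d r s u u := by
  apply mul_left_cancel₀ (two_ne_zero_of_not_even hd)
  rw [← oddEquiv_dbl hd (beta d r s u u), dbl_beta_self, map_mul, map_ofNat]

/-- For odd `d`, the character `x ↦ τ^x` of `ℤ/d`. -/
def oddChar (hd : ¬ Even d) : AddChar (ZMod d) ℂ :=
  (tauChar d).compAddMonoidHom (oddEquiv hd).symm.toAddEquiv.toAddMonoidHom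

theorem oddChar_oddEquiv (hd : ¬ Even d) (x : ZMod (bigD d)) :
    oddChar hd (oddEquiv hd x) = tauChar d x :=
  congrArg (tauChar d) ((oddEquiv hd).symm_apply_apply x)

theorem oddChar_isPrimitive (hd : ¬ Even d) : (oddChar hd).IsPrimitive := by
  refine AddChar.IsPrimitive.of_ne_one fun h => ?_
  have h1 : (ZMod.stdAddChar (1 : ZMod d) : ℂ) = ZMod.stdAddChar (0 : ZMod d) := by
    rw [← tauChar_dbl, ← oddChar_oddEquiv hd, h, AddChar.map_zero_eq_one, AddChar.one_apply]
  exact one_ne_zero (ZMod.injective_stdAddChar h1)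

theorem quadGauss_eq_sum_oddChar (hd : ¬ Even d) (a : ZMod (bigD d)) :
    quadGauss d a = ∑ x, oddChar hd (oddEquiv hd a * x ^ 2) := by
  refine Finset.sum_congr rfl fun x _ => ?_
  rw [← oddChar_oddEquiv hd, map_mul, oddEquiv_sq]

theorem ringChar_zmod_ne_two (hd : ¬ Even d) : ringChar (ZMod d) ≠ 2 := by
  rw [ZMod.ringChar_zmod_n]
  rintro rfl
  exact hd even_two

theorem quadGauss_neg_one (hd : ¬ Even d) :
    ∃ c : ℂ, c * c = 1 ∧ quadGauss d (-1) = c * quadGauss d 1 := by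
  refine ⟨quadChar (ZMod d) (-1), quadChar_sq (neg_ne_zero.mpr one_ne_zero), ?_⟩
  rw [quadGauss_eq_sum_oddChar hd, quadGauss_eq_sum_oddChar hd, map_neg, map_one,
    sum_addChar_mul_sq (ringChar_zmod_ne_two hd) (oddChar_isPrimitive hd)
      (neg_ne_zero.mpr one_ne_zero),
    sum_addChar_mul_sq (ringChar_zmod_ne_two hd) (oddChar_isPrimitive hd) one_ne_zero,
    map_one, one_mul]

theorem quadGauss_one_ne_zero : quadGauss d 1 ≠ 0 ∧ quadGauss d (-1) ≠ 0 := by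
  have h := quadGauss_one_mul_neg_one (d := d)
  have hd : (d : ℂ) ≠ 0 := Nat.cast_ne_zero.mpr (NeZero.ne d)
  exact ⟨left_ne_zero_of_mul (h ▸ hd), right_ne_zero_of_mul (h ▸ hd)⟩

theorem prod_quadGauss_sgn (r s : ℕ) :
    ∏ i, quadGauss d (sgn r s i) = quadGauss d 1 ^ r * quadGauss d (-1) ^ s := by
  rw [Fin.prod_univ_add]
  simp [sgn]

/-- Writing the sum at `-1` as `c` times the sum at `1`, the two sides differ only by `c^s` against
`c^(m + s')`. As `c² = 1`, the parity condition suffices. -/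
theorem quadGauss_pow_eq (hd : ¬ Even d) {m r' s' : ℕ} (hdim : r + s = r' + s' + 2 * m)
    (hpar : (s : ℤ) - m ≡ s' [ZMOD 2]) :
    quadGauss d 1 ^ r * quadGauss d (-1) ^ s =
      (d : ℂ) ^ m * (quadGauss d 1 ^ r' * quadGauss d (-1) ^ s') := by
  obtain ⟨c, hc, h⟩ := quadGauss_neg_one hd
  rw [← quadGauss_one_mul_neg_one, h]
  have e1 : ∀ a b : ℕ, quadGauss d 1 ^ a * (c * quadGauss d 1) ^ b =
      c ^ b * quadGauss d 1 ^ (a + b) := by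
    intro a b; rw [mul_pow, pow_add]; ring
  have e2 : (quadGauss d 1 * (c * quadGauss d 1)) ^ m = c ^ m * quadGauss d 1 ^ (2 * m) := by
    rw [pow_mul, ← mul_pow]; ring
  rw [e1, e1, e2, hdim]
  have e3 : c ^ s = c ^ (m + s') := by
    have hper : ∀ k, c ^ k = c ^ (k % 2) := by
      intro k
      conv_lhs => rw [← Nat.div_add_mod k 2, pow_add, pow_mul, pow_two, hc, one_pow, one_mul]
    rw [hper s, hper (m + s')]
    congr 1
    have := hpar.dvd
    omega
  rw [e3]
  ring

theorem exists_codeModel_odd (hd : ¬ Even d) {N : Submodule (ZMod d) (Fin (r + s) → ZMod d)}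
    (hiso : IsIsotropic N) (hstoch : IsStochastic N) (hone : (1 : Fin (r + s) → ZMod d) ∉ N)
    {r' s' : ℕ} (hdim : r + s = r' + s' + 2 * Module.finrank (ZMod d) N)
    (hmod : (r : ℤ) - s ≡ r' - s' [ZMOD d])
    (hpar : (s : ℤ) - Module.finrank (ZMod d) N ≡ s' [ZMOD 2]) :
    ∃ Φ : (Fin (r' + s') → ZMod d) →ₗ[ZMod d] (Fin (r + s) → ZMod d), IsCodeModel N Φ := by
  have hrad := isRadical_orthogonal hiso
  have hrank := (finrank_orthogonal_eq hiso).2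
  have h2 := two_ne_zero_of_not_even hd
  have hsgn : ∀ (a b : ℕ) (i : Fin (a + b)), (sgn a b i : ZMod d) ≠ 0 := fun a b i h => by
    have := sgn_cast_mul_self (R := ZMod d) i
    rw [h, zero_mul] at this
    exact zero_ne_one this
  -- If the model were zero, then `N = N^⊥`, which contains `1`.
  obtain ⟨k, hk⟩ : ∃ k, r' + s' = k + 1 := by
    refine Nat.exists_eq_add_one_of_ne_zero fun h0 => hone ?_
    have : N = (beta d r s).orthogonal N :=
      Submodule.eq_of_le_of_finrank_eq (le_orthogonal_self hiso) (by omega)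
    rw [this]
    exact hstoch
  have hcard : Fintype.card (ZMod d) % 2 = 1 := by
    rw [ZMod.card]; exact Nat.not_even_iff.mp hd
  obtain ⟨φ, l, hφ, hφw, hφl⟩ : ∃ (φ : Fin (r' + s') → Fin (r + s) → ZMod d) (l : Fin (r' + s')),
      IsOrthoFamily (beta d r s) ((beta d r s).orthogonal N) φ ∧
      (∀ i, i ≠ l → beta d r s (φ i) (φ i) = sgn r' s' i) ∧ beta d r s (φ l) (φ l) ≠ 0 := by
    have key : ∀ (a : ℕ) (ha : a = k + 1) (w : Fin a → ZMod d), (∀ i, w i ≠ 0) →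
        ∃ (φ : Fin a → Fin (r + s) → ZMod d) (l : Fin a),
          IsOrthoFamily (beta d r s) ((beta d r s).orthogonal N) φ ∧
          (∀ i, i ≠ l → beta d r s (φ i) (φ i) = w i) ∧ beta d r s (φ l) (φ l) ≠ 0 := by
      rintro a rfl w hw
      obtain ⟨φ, h1, h3, h4⟩ := hrad.exists_orthoFamily hcard h2 beta_comm k (by omega) w hw
      exact ⟨φ, _, h1, h3, h4⟩
    exact key _ hk (fun i => (sgn r' s' i : ZMod d)) fun i => hsgn _ _ i
  have hprod := prod_quadGauss hiso hdim hφ fun i => by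
    by_cases hi : i = l
    · rw [hi]; exact hφl
    · rw [hφw i hi]; exact hsgn _ _ i
  have hq : ∀ u : Fin (r + s) → ZMod d, ∀ c : ℤ, beta d r s u u = c → quad d r s u = c := by
    intro u c hc
    apply (oddEquiv hd).injective
    rw [oddEquiv_quad, hc, map_intCast]
  rw [quadGauss_pow_eq hd hdim hpar, ← prod_quadGauss_sgn] at hprod
  have hprod2 := mul_left_cancel₀ (pow_ne_zero _ (Nat.cast_ne_zero.mpr (NeZero.ne d))) hprod
  have hrest : ∏ i ∈ Finset.univ.erase l, quadGauss d (quad d r s (φ i)) =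
      ∏ i ∈ Finset.univ.erase l, quadGauss d (sgn r' s' i) :=
    Finset.prod_congr rfl fun i hi => by rw [hq _ _ (hφw i (Finset.ne_of_mem_erase hi))]
  rw [← Finset.mul_prod_erase _ _ (Finset.mem_univ l),
    ← Finset.mul_prod_erase _ (fun i => quadGauss d (quad d r s (φ i))) (Finset.mem_univ l),
    hrest] at hprod2
  have hg0 : ∀ i : Fin (r' + s'), quadGauss d (sgn r' s' i) ≠ 0 := by
    intro i
    unfold sgn
    split_ifs
    · simpa using quadGauss_one_ne_zero.1
    · simpa using quadGauss_one_ne_zero.2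
  -- All other factors agree and are nonzero, so the Gauss sums at the one unprescribed norm agree,
  -- which fixes its square class.
  have hlast := mul_right_cancel₀ (Finset.prod_ne_zero_iff.mpr fun i _ => hg0 i) hprod2
  rw [quadGauss_eq_sum_oddChar hd, quadGauss_eq_sum_oddChar hd, oddEquiv_quad,
    map_intCast] at hlast
  obtain ⟨c, hc0, hc⟩ := exists_eq_mul_sq_of_sum_eq (ringChar_zmod_ne_two hd)
    (oddChar_isPrimitive hd) (hsgn _ _ l) hφl hlast
  obtain ⟨χ, hχ, hχw⟩ : ∃ χ : Fin (r' + s') → Fin (r + s) → ZMod d,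
      IsOrthoFamily (beta d r s) ((beta d r s).orthogonal N) χ ∧
      ∀ i, beta d r s (χ i) (χ i) = sgn r' s' i := by
    refine ⟨fun i => (if i = l then c else 1) • φ i,
      ⟨fun i => Submodule.smul_mem _ _ (hφ.mem i), fun i j hij => ?_⟩, fun i => ?_⟩
    · rw [map_smul, map_smul, LinearMap.smul_apply, hφ.ortho i j hij, smul_zero, smul_zero]
    · rw [map_smul, map_smul, LinearMap.smul_apply, smul_eq_mul, smul_eq_mul]
      split_ifs with hi
      · rw [hi, hc]; ring
      · rw [hφw i hi]; ring
  have hsum : ∀ j, beta d r s (∑ i, χ i) (χ j) = sgn r' s' j := by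
    intro j
    rw [map_sum, LinearMap.sum_apply, Finset.sum_eq_single j, hχw]
    · intro i _ hij; exact hχ.ortho i j hij
    · simp
  have hnorm : ∀ a b : ℕ, ∑ i : Fin (a + b), (sgn a b i : ZMod d) = (a : ZMod d) - b := by
    intro a b
    rw [Fin.sum_univ_add]
    simp [sgn]
    ring
  have hsumN : ∑ i, χ i ∉ N := by
    intro h
    have h1 := hsum l
    rw [hχ.mem l _ h] at h1
    exact hsgn _ _ l h1.symm
  -- The norms are `r' - s'` and `r - s`, equal modulo `d` by `hmod`; this is the hypothesis of
  -- Witt's theorem.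
  have heq : beta d r s (∑ i, χ i) (∑ i, χ i) = beta d r s 1 1 := by
    rw [map_sum (beta d r s (∑ i, χ i)), Finset.sum_congr rfl fun j _ => hsum j, hnorm,
      beta_apply]
    simp only [Pi.one_apply, mul_one, hnorm]
    have := (ZMod.intCast_eq_intCast_iff _ _ d).mpr hmod
    push_cast at this
    exact this.symm
  obtain ⟨σ, hσ, hσ1⟩ := hrad.exists_isometry h2 beta_comm
    (Submodule.sum_mem _ fun i _ => hχ.mem i) hstoch hsumN hone heq
  refine ⟨_, isCodeModel_of_family (φ := fun i => σ (χ i)) hdim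
    ⟨fun i => hσ.mem _ (hχ.mem i), fun i j hij => by rw [hσ.apply_eq]; exact hχ.ortho i j hij⟩
    (fun i => hq _ _ (by rw [hσ.apply_eq]; exact hχw i)) ?_⟩
  rw [← map_sum, hσ1, sub_self]
  exact N.zero_mem

end Odd

/-! ### Models of codes in characteristic two -/

section Even

theorem zmod_two_eq_one {a : ZMod 2} (h : a ≠ 0) : a = 1 := by
  revert a; decide

/-! ### Orthogonal families over the field with two elements. -/

section Bilinear

variable {T : Type*} [AddCommGroup T] [Module (ZMod 2) T] {B : LinearMap.BilinForm (ZMod 2) T}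

/-- The complement of `v` may be alternating. Then it contains `a`, `b` with `B a b = 1`, and `v +
a`, `v + b` are orthogonal of norm 1, so `v + a` is a better choice. -/
theorem IsRadical.exists_anisotropic_cut [FiniteDimensional (ZMod 2) T]
    (hsymm : ∀ u v, B u v = B v u) {W N : Submodule (ZMod 2) T} (h : IsRadical B W N) {v : T}
    (hv : v ∈ W) (hvv : B v v ≠ 0)
    (hlt : Module.finrank (ZMod 2) N + 1 < Module.finrank (ZMod 2) W) :
    ∃ v ∈ W, B v v ≠ 0 ∧ ∃ u ∈ W ⊓ LinearMap.ker (B v), B u u ≠ 0 := by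
  by_cases hodd : ∃ u ∈ W ⊓ LinearMap.ker (B v), B u u ≠ 0
  · exact ⟨v, hv, hvv, hodd⟩
  · push Not at hodd
    have hcut := finrank_cut hv hvv
    obtain ⟨a, ha, haN⟩ : ∃ a ∈ W ⊓ LinearMap.ker (B v), a ∉ N :=
      IsRadical.exists_mem_notMem (by omega)
    obtain ⟨b, hb, hab⟩ := (h.cut hsymm hv hvv).exists_apply_ne_zero ha haN
    have hva := (mem_cut.mp ha).2
    have hvb := (mem_cut.mp hb).2
    have h11 : (1 : ZMod 2) + 1 = 0 := rfl
    refine ⟨v + a, W.add_mem hv ha.1, ?_, v + b, mem_cut.mpr ⟨W.add_mem hv hb.1, ?_⟩, ?_⟩ <;>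
    simp only [map_add, LinearMap.add_apply, hsymm a v, hsymm b v, hva, hvb, hodd a ha,
      hodd b hb, zmod_two_eq_one hvv, zmod_two_eq_one hab, add_zero, zero_add, h11] <;> simp

theorem IsRadical.exists_orthoFamily_two [FiniteDimensional (ZMod 2) T]
    (hsymm : ∀ u v, B u v = B v u) {N : Submodule (ZMod 2) T} (k : ℕ) :
    ∀ {W : Submodule (ZMod 2) T} (_ : IsRadical B W N)
      (_ : Module.finrank (ZMod 2) W = Module.finrank (ZMod 2) N + k)
      (_ : k ≠ 0 → ∃ v ∈ W, B v v ≠ 0),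
      ∃ φ : Fin k → T, IsOrthoFamily B W φ ∧ ∀ i, B (φ i) (φ i) ≠ 0 := by
  induction k with
  | zero => exact fun _ _ _ => ⟨fun i => i.elim0, ⟨fun i => i.elim0, fun i => i.elim0⟩,
      fun i => i.elim0⟩
  | succ k ih =>
    intro W h hdim hodd
    obtain ⟨v, hv, hvv, hcut⟩ : ∃ v ∈ W, B v v ≠ 0 ∧
        (k ≠ 0 → ∃ u ∈ W ⊓ LinearMap.ker (B v), B u u ≠ 0) := by
      obtain ⟨v, hv, hvv⟩ := hodd (Nat.succ_ne_zero k)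
      by_cases hk : k = 0
      · exact ⟨v, hv, hvv, fun h => absurd hk h⟩
      · obtain ⟨v, hv, hvv, hu⟩ := h.exists_anisotropic_cut hsymm hv hvv (by omega)
        exact ⟨v, hv, hvv, fun _ => hu⟩
    have hrank := finrank_cut hv hvv
    obtain ⟨φ, h1, h3⟩ := ih (h.cut hsymm hv hvv) (by omega) hcut
    exact ⟨Fin.cons v φ, h1.cons hsymm hv, Fin.cases hvv h3⟩

end Bilinear

variable {r s : ℕ}

theorem dbl_two_one : dbl (1 : ZMod 2) = 2 := by simpa using dbl_intCast (d := 2) 1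

theorem quad_eq_one_or {u : Fin (r + s) → ZMod 2} (h : beta 2 r s u u ≠ 0) :
    quad 2 r s u = 1 ∨ quad 2 r s u = -1 := by
  have h1 := dbl_beta_self u
  rw [zmod_two_eq_one h] at h1
  rw [dbl_two_one] at h1
  have h3 : ∀ x : ZMod (bigD 2), 2 = 2 * x → x = 1 ∨ x = -1 := by decide
  exact h3 _ h1

theorem bigD_two_facts : (4 : ZMod (bigD 2)) = 0 ∧ (1 : ZMod (bigD 2)) ≠ -1 := by decide

/-- `W` has an orthogonal family of `k` vectors with `q = ±1`, exactly `p` of which have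
`q = 1`. -/
def HasSignature (W : Submodule (ZMod 2) (Fin (r + s) → ZMod 2)) (k p : ℕ) : Prop :=
  ∃ φ : Fin k → Fin (r + s) → ZMod 2, IsOrthoFamily (beta 2 r s) W φ ∧
    (∀ i, beta 2 r s (φ i) (φ i) ≠ 0) ∧ Fintype.card {i // quad 2 r s (φ i) = 1} = p

/-- Let `σ` be the sum over `S`. It has `q(σ) = 4a = 0` and pairs to 1 exactly with the members of
`S`. Adding `σ` to these keeps the Gram matrix and shifts `q` by 2, exchanging 1 and -1. -/
theorem exists_flip {W : Submodule (ZMod 2) (Fin (r + s) → ZMod 2)} {k : ℕ}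
    {φ : Fin k → Fin (r + s) → ZMod 2} (hφ : IsOrthoFamily (beta 2 r s) W φ)
    (hφ1 : ∀ i, beta 2 r s (φ i) (φ i) ≠ 0) {S : Finset (Fin k)} (hS : S.card = 4)
    {a : ZMod (bigD 2)} (ha : ∀ i ∈ S, quad 2 r s (φ i) = a) :
    ∃ χ : Fin k → Fin (r + s) → ZMod 2, IsOrthoFamily (beta 2 r s) W χ ∧
      (∀ i, beta 2 r s (χ i) (χ i) ≠ 0) ∧
      ∀ i, quad 2 r s (χ i) = if i ∈ S then a + 2 else quad 2 r s (φ i) := by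
  obtain ⟨σ, hσ⟩ : ∃ σ, σ = ∑ i ∈ S, φ i := ⟨_, rfl⟩
  have h1 : ∀ i, beta 2 r s (φ i) (φ i) = 1 := fun i => zmod_two_eq_one (hφ1 i)
  have hσφ : ∀ j, beta 2 r s σ (φ j) = if j ∈ S then 1 else 0 := by
    intro j
    rw [hσ, map_sum, LinearMap.sum_apply, ← Finset.sum_ite_eq S j fun _ => (1 : ZMod 2)]
    refine Finset.sum_congr rfl fun i _ => ?_
    by_cases hij : j = i
    · subst hij; rw [if_pos rfl, h1]
    · rw [if_neg hij, hφ.ortho i j (Ne.symm hij)]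
  have hσσ : beta 2 r s σ σ = 0 := by
    have h : beta 2 r s σ σ = ∑ i ∈ S, beta 2 r s σ (φ i) := by rw [← map_sum, ← hσ]
    rw [h, Finset.sum_congr rfl fun i hi => by rw [hσφ, if_pos hi], Finset.sum_const, hS]
    rfl
  have hqσ : quad 2 r s σ = 0 := by
    have h := quad_sum φ hφ.ortho (fun _ => 1) S
    simp only [one_smul] at h
    have hsq : sq (1 : ZMod 2) = 1 := by simpa using sq_intCast (d := 2) 1
    rw [hσ, h, Finset.sum_congr rfl fun i hi => by rw [ha i hi], Finset.sum_const, hS, hsq,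
      nsmul_eq_mul]
    push_cast
    rw [bigD_two_facts.1, zero_mul]
  have hσW : σ ∈ W := hσ ▸ Submodule.sum_mem _ fun i _ => hφ.mem i
  have hb : ∀ i j, beta 2 r s (φ i + (if i ∈ S then (1 : ZMod 2) else 0) • σ)
      (φ j + (if j ∈ S then (1 : ZMod 2) else 0) • σ) = beta 2 r s (φ i) (φ j) := by
    intro i j
    have h20 : ∀ x : ZMod 2, x + x = 0 := by decide
    simp only [map_add, map_smul, LinearMap.add_apply, LinearMap.smul_apply, smul_eq_mul,
      hσσ, hσφ, beta_comm (φ i) σ, mul_zero, add_zero]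
    rw [add_assoc, mul_comm, h20, add_zero]
  refine ⟨fun i => φ i + (if i ∈ S then (1 : ZMod 2) else 0) • σ,
    ⟨fun i => W.add_mem (hφ.mem i) (W.smul_mem _ hσW), fun i j hij => ?_⟩, fun i => ?_,
    fun i => ?_⟩
  · rw [hb]; exact hφ.ortho i j hij
  · rw [hb]; exact hφ1 i
  · rw [quad_add, quad_smul, hqσ, mul_zero, add_zero, map_smul, beta_comm, hσφ]
    split_ifs with hi
    · rw [ha i hi, smul_eq_mul, mul_one, dbl_two_one]
    · rw [smul_zero, dbl_zero, add_zero]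

theorem HasSignature.add_four {W : Submodule (ZMod 2) (Fin (r + s) → ZMod 2)} {k p : ℕ}
    (h : HasSignature W k p) (hp : p + 4 ≤ k) : HasSignature W k (p + 4) := by
  obtain ⟨φ, hφ, hφ1, hc⟩ := h
  rw [Fintype.card_subtype] at hc
  have hcompl := Finset.card_filter_add_card_filter_not (s := Finset.univ)
    (fun i => quad 2 r s (φ i) = 1)
  rw [hc, Finset.card_univ, Fintype.card_fin] at hcompl
  obtain ⟨S, hS, hS4⟩ := Finset.exists_subset_card_eq
    (show 4 ≤ (Finset.univ.filter fun i => ¬ quad 2 r s (φ i) = 1).card by omega)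
  have hSm : ∀ i ∈ S, quad 2 r s (φ i) = -1 := fun i hi =>
    (quad_eq_one_or (hφ1 i)).resolve_left (Finset.mem_filter.mp (hS hi)).2
  obtain ⟨χ, hχ, hχ1, hχq⟩ := exists_flip hφ hφ1 hS4 hSm
  refine ⟨χ, hχ, hχ1, ?_⟩
  have h3 : (-1 + 2 : ZMod (bigD 2)) = 1 := by ring
  have hset : (Finset.univ.filter fun i => quad 2 r s (χ i) = 1) =
      (Finset.univ.filter fun i => quad 2 r s (φ i) = 1) ∪ S := by
    ext i
    rw [Finset.mem_union, Finset.mem_filter, Finset.mem_filter, hχq, h3]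
    split_ifs with hi <;> simp [hi]
  rw [Fintype.card_subtype, hset, Finset.card_union_of_disjoint, hc, hS4]
  refine Finset.disjoint_left.mpr fun i hi hiS => ?_
  exact (Finset.mem_filter.mp (hS hiS)).2 (Finset.mem_filter.mp hi).2

theorem HasSignature.of_add_four {W : Submodule (ZMod 2) (Fin (r + s) → ZMod 2)} {k p : ℕ}
    (h : HasSignature W k (p + 4)) : HasSignature W k p := by
  obtain ⟨φ, hφ, hφ1, hc⟩ := h
  rw [Fintype.card_subtype] at hc
  obtain ⟨S, hS, hS4⟩ := Finset.exists_subset_card_eq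
    (show 4 ≤ (Finset.univ.filter fun i => quad 2 r s (φ i) = 1).card by omega)
  obtain ⟨χ, hχ, hχ1, hχq⟩ := exists_flip hφ hφ1 hS4
    fun i hi => (Finset.mem_filter.mp (hS hi)).2
  refine ⟨χ, hχ, hχ1, ?_⟩
  have h3 : (1 + 2 : ZMod (bigD 2)) ≠ 1 := by decide
  have hset : (Finset.univ.filter fun i => quad 2 r s (χ i) = 1) =
      (Finset.univ.filter fun i => quad 2 r s (φ i) = 1) \ S := by
    ext i
    rw [Finset.mem_sdiff, Finset.mem_filter, Finset.mem_filter, hχq]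
    split_ifs with hi <;> simp [hi, h3]
  rw [Fintype.card_subtype, hset, Finset.card_sdiff_of_subset hS, hc, hS4, Nat.add_sub_cancel]

theorem HasSignature.of_modEq {W : Submodule (ZMod 2) (Fin (r + s) → ZMod 2)} {k p p' : ℕ}
    (h : HasSignature W k p) (hp' : p' ≤ k) (hmod : p ≡ p' [MOD 4]) : HasSignature W k p' := by
  have up : ∀ j p, HasSignature W k p → p + 4 * j ≤ k → HasSignature W k (p + 4 * j) := by
    intro j
    induction j with
    | zero => exact fun p h _ => h
    | succ j ih => exact fun p h hj => (ih p h (by omega)).add_four (by omega)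
  have down : ∀ j p, HasSignature W k (p + 4 * j) → HasSignature W k p := by
    intro j
    induction j with
    | zero => exact fun p h => h
    | succ j ih => exact fun p h => ih p h.of_add_four
  have hmod' : p % 4 = p' % 4 := hmod
  rcases le_total p p' with hle | hle
  · have : p' = p + 4 * ((p' - p) / 4) := by omega
    rw [this]
    exact up _ _ h (by omega)
  · have : p = p' + 4 * ((p - p') / 4) := by omega
    rw [this] at h
    exact down _ _ h

theorem HasSignature.exists_family {W : Submodule (ZMod 2) (Fin (r + s) → ZMod 2)} {r' s' : ℕ}
    (h : HasSignature W (r' + s') r') :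
    ∃ φ : Fin (r' + s') → Fin (r + s) → ZMod 2, IsOrthoFamily (beta 2 r s) W φ ∧
      ∀ i, quad 2 r s (φ i) = sgn r' s' i := by
  obtain ⟨φ, hφ, hφ1, hc⟩ := h
  have hcard : Fintype.card {i : Fin (r' + s') // (i : ℕ) < r'} =
      Fintype.card {i // quad 2 r s (φ i) = 1} := by
    rw [hc, Fintype.card_subtype, Fin.card_filter_val_lt]
    omega
  obtain ⟨e⟩ := Fintype.card_eq.mp hcard
  refine ⟨fun i => φ (e.extendSubtype i), ⟨fun i => hφ.mem _, fun i j hij =>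
    hφ.ortho _ _ fun h => hij (e.extendSubtype.injective h)⟩, fun i => ?_⟩
  unfold sgn
  split_ifs with hi
  · rw [e.extendSubtype_mem i hi, Int.cast_one]
  · rw [(quad_eq_one_or (hφ1 _)).resolve_left (e.extendSubtype_not_mem i hi), Int.cast_neg,
      Int.cast_one]

theorem quadGauss_two_one : quadGauss 2 1 = 1 + Complex.I := by
  have ht : tauChar 2 1 = Complex.I := by
    have h := tauChar_intCast (d := 2) 1
    rw [Int.cast_one, zpow_one] at h
    rw [h, tau]
    have : Complex.I * Real.pi / (2 : ℕ) = Real.pi / 2 * Complex.I := by push_cast; ring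
    rw [this, Complex.exp_pi_div_two_mul_I]
    norm_num
  have hsq : sq (1 : ZMod 2) = 1 := by simpa using sq_intCast (d := 2) 1
  have : quadGauss 2 1 = tauChar 2 (1 * sq 0) + tauChar 2 (1 * sq 1) := Fin.sum_univ_two _
  rw [this, sq_zero, hsq, mul_zero, mul_one, ht, AddChar.map_zero_eq_one]

theorem quadGauss_two_neg_one : quadGauss 2 1 = Complex.I * quadGauss 2 (-1) := by
  apply mul_left_cancel₀ (quadGauss_one_ne_zero (d := 2)).1
  have h : quadGauss 2 1 * (Complex.I * quadGauss 2 (-1)) =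
      Complex.I * (quadGauss 2 1 * quadGauss 2 (-1)) := by ring
  rw [h, quadGauss_one_mul_neg_one, quadGauss_two_one]
  push_cast
  linear_combination Complex.I_sq

/-- Every element of the field satisfies `x = x²`, so the all-ones vector is characteristic. -/
theorem beta_one_left (y : Fin (r + s) → ZMod 2) : beta 2 r s 1 y = beta 2 r s y y := by
  rw [beta_apply, beta_apply]
  have h : ∀ x : ZMod 2, 1 * x = x * x := by decide
  simp only [Pi.one_apply, h]

/-- The Gauss sum at `1` is `i` times the one at `-1`, so comparing the sums over `T` and `N^⊥`
gives `i^r = i^(m + p)`, and `i` has order 4. -/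
theorem exists_hasSignature {N : Submodule (ZMod 2) (Fin (r + s) → ZMod 2)}
    (hiso : IsIsotropic N) (hstoch : IsStochastic N) (hone : (1 : Fin (r + s) → ZMod 2) ∉ N)
    {k : ℕ} (hdim : r + s = k + 2 * Module.finrank (ZMod 2) N) :
    ∃ p, HasSignature ((beta 2 r s).orthogonal N) k p ∧ p ≤ k ∧
      r ≡ Module.finrank (ZMod 2) N + p [MOD 4] := by
  have hrad := isRadical_orthogonal hiso
  have hrank := (finrank_orthogonal_eq hiso).2
  obtain ⟨φ, hφ, hφ1⟩ := hrad.exists_orthoFamily_two beta_comm k (by omega) fun _ => by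
    obtain ⟨y, hy, hy1⟩ := hrad.exists_apply_ne_zero hstoch hone
    exact ⟨y, hy, by rwa [← beta_one_left]⟩
  refine ⟨_, ⟨φ, hφ, hφ1, rfl⟩, (Fintype.card_subtype_le _).trans (by simp), ?_⟩
  obtain ⟨p, hp⟩ : ∃ p, p = Fintype.card {i // quad 2 r s (φ i) = 1} := ⟨_, rfl⟩
  obtain ⟨m, hm⟩ : ∃ m, m = Module.finrank (ZMod 2) N := ⟨_, rfl⟩
  have hprod := prod_quadGauss hiso hdim hφ hφ1
  have hval : ∀ i, quadGauss 2 (quad 2 r s (φ i)) =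
      (if quad 2 r s (φ i) = 1 then Complex.I else 1) * quadGauss 2 (-1) := by
    intro i
    rcases quad_eq_one_or (hφ1 i) with h | h
    · rw [h, if_pos rfl, quadGauss_two_neg_one]
    · rw [h, if_neg bigD_two_facts.2.symm, one_mul]
  rw [Finset.prod_congr rfl fun i _ => hval i, Finset.prod_mul_distrib, Finset.prod_ite,
    Finset.prod_const, Finset.prod_const_one, Finset.prod_const, Finset.card_univ,
    Fintype.card_fin, ← Fintype.card_subtype, ← hp, ← hm, ← quadGauss_one_mul_neg_one,
    quadGauss_two_neg_one, mul_one] at hprod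
  rw [← hp, ← hm]
  rw [← hm] at hdim
  have e1 : (Complex.I * quadGauss 2 (-1)) ^ r * quadGauss 2 (-1) ^ s =
      Complex.I ^ r * quadGauss 2 (-1) ^ (r + s) := by rw [mul_pow, pow_add]; ring
  have e2 : (Complex.I * quadGauss 2 (-1) * quadGauss 2 (-1)) ^ m *
      (Complex.I ^ p * quadGauss 2 (-1) ^ k) =
      Complex.I ^ (m + p) * quadGauss 2 (-1) ^ (k + 2 * m) := by
    rw [mul_assoc, mul_pow, pow_add, pow_add, pow_mul, pow_two]; ring
  rw [e1, e2, ← hdim] at hprod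
  have h := mul_right_cancel₀ (pow_ne_zero _ (quadGauss_one_ne_zero (d := 2)).2) hprod
  have hI := Complex.isPrimitiveRoot_I
  rw [hI.eq_orderOf]
  exact (hI.isOfFinOrder (by norm_num)).pow_eq_pow_iff_modEq.mp h

theorem exists_codeModel_two {N : Submodule (ZMod 2) (Fin (r + s) → ZMod 2)}
    (hiso : IsIsotropic N) (hstoch : IsStochastic N) (hone : (1 : Fin (r + s) → ZMod 2) ∉ N)
    {r' s' : ℕ} (hdim : r + s = r' + s' + 2 * Module.finrank (ZMod 2) N)
    (hmod : r ≡ Module.finrank (ZMod 2) N + r' [MOD 4]) :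
    ∃ Φ : (Fin (r' + s') → ZMod 2) →ₗ[ZMod 2] (Fin (r + s) → ZMod 2), IsCodeModel N Φ := by
  obtain ⟨p, hp, -, hpmod⟩ := exists_hasSignature hiso hstoch hone hdim
  have hpr : p ≡ r' [MOD 4] := Nat.ModEq.add_left_cancel' _ (hpmod.symm.trans hmod)
  obtain ⟨φ, hφ, hq⟩ := (hp.of_modEq (by omega) hpr).exists_family
  have hφ0 : ∀ i, beta 2 r s (φ i) (φ i) ≠ 0 := by
    intro i h
    have h1 := dbl_beta_self (φ i)
    rw [h, dbl_zero, hq] at h1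
    have h2 : (0 : ZMod (bigD 2)) ≠ 2 * 1 ∧ (0 : ZMod (bigD 2)) ≠ 2 * (-1) := by decide
    unfold sgn at h1
    split_ifs at h1
    · exact h2.1 (by simpa using h1)
    · exact h2.2 (by simpa using h1)
  refine ⟨_, isCodeModel_of_family hdim hφ hq ?_⟩
  have hmem : ∑ i, φ i - 1 ∈ (beta 2 r s).orthogonal N :=
    Submodule.sub_mem _ (Submodule.sum_mem _ fun i _ => hφ.mem i) hstoch
  -- Both `1` and the sum of the family are characteristic on `N^⊥`, so their difference lies in its
  -- radical, which is `N`.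
  refine (isRadical_orthogonal hiso _).mpr ⟨hmem, fun y hy => ?_⟩
  obtain ⟨e, he⟩ := exists_equiv_orthogonal hiso (Fintype.linearCombination (ZMod 2) φ)
    (linearCombination_mem hφ) (fun x => eq_zero_of_linearCombination_mem hφ hφ0) hdim
  have hye := he (e.symm ⟨y, hy⟩)
  rw [Equiv.apply_symm_apply] at hye
  change y = _ at hye
  have hφj : ∀ j, beta 2 r s (∑ i, φ i - 1) (φ j) = 0 := by
    intro j
    rw [map_sub, LinearMap.sub_apply, map_sum, LinearMap.sum_apply, Finset.sum_eq_single j,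
      beta_one_left, sub_self]
    · intro i _ hij; exact hφ.ortho i j hij
    · simp
  rw [hye, map_add, beta_comm, hmem _ (e.symm ⟨y, hy⟩).1.2, zero_add,
    Fintype.linearCombination_apply, map_sum]
  exact Finset.sum_eq_zero fun j _ => by rw [map_smul, hφj, smul_zero]

end Even

end CliffordTensor

end

theorem mainTheorem10 (d : ℕ) [Fact d.Prime] (n r s m : ℕ)
    (N : Submodule (ZMod d) (Fin (r + s) → ZMod d))
    (hiso : CliffordTensor.IsIsotropic N) (hstoch : CliffordTensor.IsStochastic N)
    (hone : (1 : Fin (r + s) → ZMod d) ∉ N)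
    (hdim : Module.finrank (ZMod d) N = m) :
    ∃ hinv : ∀ U, CliffordTensor.codeSpace n N ≤
        (CliffordTensor.codeSpace n N).comap (CliffordTensor.Delta d n r s U),
      (d = 2 →
        ∃ r' s' : ℕ, CliffordTensor.ExtendsTo d ((r : ℤ) - m) ((s : ℤ) - m) r' s') ∧
      ∀ r' s' : ℕ, CliffordTensor.ExtendsTo d ((r : ℤ) - m) ((s : ℤ) - m) r' s' →
        Nonempty (Representation.Equiv
          ((CliffordTensor.Delta d n r s).subrepresentation (CliffordTensor.codeSpace n N) hinv)
          (CliffordTensor.Delta d n r' s')) := by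
  have hle := (CliffordTensor.finrank_orthogonal_eq hiso).1
  rw [hdim] at hle
  refine ⟨CliffordTensor.codeSpace_le_comap hiso hstoch, ?_, fun r' s' hext => ?_⟩
  · rintro rfl
    obtain ⟨p, -, hp, hmod⟩ := CliffordTensor.exists_hasSignature hiso hstoch hone
      (k := r + s - 2 * m) (by omega)
    rw [hdim] at hmod
    have h4 : r % 4 = (m + p) % 4 := hmod
    -- The pair is the signature realized in `N^⊥`. Given `r + s = r' + s' + 2m`, the congruence
    -- modulo 8 is equivalent to `r ≡ m + r'` modulo 4.
    refine ⟨p, r + s - 2 * m - p, by omega, ?_⟩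
    rw [if_pos rfl]
    refine (Int.modEq_iff_dvd).mpr ?_
    omega
  · obtain ⟨h1, h2⟩ := hext
    have hdim' : r + s = r' + s' + 2 * Module.finrank (ZMod d) N := by omega
    have hmodel : ∃ Φ : (Fin (r' + s') → ZMod d) →ₗ[ZMod d] (Fin (r + s) → ZMod d),
        CliffordTensor.IsCodeModel N Φ := by
      by_cases hd : d = 2
      · subst hd
        rw [if_pos rfl] at h2
        refine CliffordTensor.exists_codeModel_two hiso hstoch hone hdim' ?_
        have h8 := h2.dvd
        change r % 4 = (_ + r') % 4
        omega
      · rw [if_neg hd, ← hdim, sub_sub_sub_cancel_right] at h2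
        exact CliffordTensor.exists_codeModel_odd (CliffordTensor.not_even_of_ne_two hd) hiso
          hstoch hone hdim' h2.1 h2.2
    obtain ⟨Φ, hΦ⟩ := hmodel
    exact hΦ.nonempty_equiv hiso hstoch _
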